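/- Let $\mathbb H$ be the quaternions and $\mathbb B=\{p\in\mathbb H:|p|<1\}$. A function $f$ on $\mathbb B$ is slice regular if it is real differentiable and $\frac{\partial}{\partial x}f(x+Iy)+I\frac{\partial}{\partial y}f(x+Iy)=0$ at all $x+Iy\in\mathbb B$ ($x,y\in\mathbb R$), for every purely imaginary $I$ with $|I|=1$; equivalently $f(p)=\sum_{k\ge0}p^kf_k$ with $f_k\in\mathbb H$, the series converging on $\mathbb B$. Let $\mathcal R(\mathbb B,\overline{\mathbb B})$ be the set of slice regular $f$ on $\mathbb B$ with $|f|\le 1$. For slice regular $g=\sum p^kg_k$, $f=\sum p^kf_k$ put $(g\star f)(p)=\sum_k p^k\sum_{r=0}^k g_rf_{k-r}$, $f^c(p)=\sum_k p^k\overline{f_k}$ and $f^{-\star}(p)=\big((f^c\star f)(p)\big)^{-1}f^c(p)$, which is defined off the zeros of $f^c\star f$. Let $p_1,\dots,p_n\in\mathbb B$ be distinct, let $s_1,\dots,s_n\in\mathbb H$, and assume that the Pick matrix $$P=\Big[\sum_{k=0}^\infty p_i^k(1-s_i\overline{s_j})\overline{p_j}^{\,k}\Big]_{i,j=1}^n$$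 is positive definite. Put $T=\mathrm{diag}(p_1,\dots,p_n)$, $E=(1,\dots,1)^{\top}$, $N=(s_1,\dots,s_n)^{\top}$ and $$\Theta(p)=\begin{bmatrix}\Theta_{11}&\Theta_{12}\\ \Theta_{21}&\Theta_{22}\end{bmatrix}(p)=\mathbf I_2+(p-1)\sum_{k=0}^\infty p^k\begin{bmatrix}E^*\\ N^*\end{bmatrix}T^{*k}P^{-1}(\mathbf I_n-T)^{-1}\begin{bmatrix}E&-N\end{bmatrix}\qquad(p\in\mathbb B).$$ Then the entries of $\Theta$ are slice regular on $\mathbb B$; for every $\mathcal E\in\mathcal R(\mathbb B,\overline{\mathbb B})$ the function $(\Theta_{21}\star\mathcal E+\Theta_{22})^{-\star}$ is defined on all of $\mathbb B$; and a function $S$ on $\mathbb B$ belongs to $\mathcal R(\mathbb B,\overline{\mathbb B})$ and satisfies $S(p_i)=s_i$ for $i=1,\dots,n$ if and only if $$S=(\Theta_{11}\star\mathcal E+\Theta_{12})\star(\Theta_{21}\star\mathcal E+\Theta_{22})^{-\star}\quad\text{on }\mathbb B$$ for some $\mathcal E\in\mathcal R(\mathbb B,\overline{\mathbb B})$. -/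

import Mathlib

open scoped Quaternion Matrix

noncomputable section

/-- The open unit ball of the quaternions. -/
def quatBall : Set ℍ := Metric.ball 0 1

/-- The sphere of imaginary units: purely imaginary quaternions of modulus one. -/
def imagUnits : Set ℍ := {I | I.re = 0 ∧ ‖I‖ = 1}

/-- (Left) slice regularity on an open set `Ω`: `f` is real differentiable on `Ω` and, on every
slice `ℂ_I = {x + I y}`, satisfies `∂f/∂x + I ∂f/∂y = 0`. -/
def SliceRegularOn (f : ℍ → ℍ) (Ω : Set ℍ) : Prop :=
  DifferentiableOn ℝ f Ω ∧
    ∀ I ∈ imagUnits, ∀ x y : ℝ, (x : ℍ) + I * (y : ℍ) ∈ Ω →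
      deriv (fun t : ℝ => f ((t : ℍ) + I * (y : ℍ))) x
        + I * deriv (fun t : ℝ => f ((x : ℍ) + I * (t : ℍ))) y = 0

/-- The class of slice regular functions from the open unit ball to the closed unit ball
(only the values on the open unit ball matter). -/
def SliceSchur (f : ℍ → ℍ) : Prop :=
  SliceRegularOn f quatBall ∧ ∀ q ∈ quatBall, ‖f q‖ ≤ 1

/-- The function `p ↦ ∑ p ^ k a_k` given by a power series with coefficients on the right. -/
def sliceEval (a : PowerSeries ℍ) (p : ℍ) : ℍ :=
  ∑' k : ℕ, p ^ k * PowerSeries.coeff k a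

/-- The Taylor coefficients `f_k` at the origin of `f(p) = ∑ p ^ k f_k`, read off along the real
axis: `f_k = (1 / k!) (d/dx)^k f(x)` at `x = 0`. -/
def sliceTaylor (f : ℍ → ℍ) : PowerSeries ℍ :=
  PowerSeries.mk fun k =>
    ((k.factorial : ℝ)⁻¹) • iteratedDeriv k (fun x : ℝ => f (x : ℍ)) 0

/-- The slice regular product
`(g ⋆ f)(p) = ∑ p ^ k (∑_{r ≤ k} g_r f_{k-r})` of functions regular on the unit ball. -/
def sliceMul (g f : ℍ → ℍ) : ℍ → ℍ :=
  sliceEval (sliceTaylor g * sliceTaylor f)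

/-- The slice regular conjugate `f^c(p) = ∑ p ^ k (conjugate of f_k)`. -/
def sliceConj (f : ℍ → ℍ) : ℍ → ℍ :=
  sliceEval (PowerSeries.mk fun k => star (PowerSeries.coeff k (sliceTaylor f)))

/-- `f^{-⋆}` is defined on the whole unit ball: `f^c ⋆ f` has no zeros there. -/
def SliceInvertible (f : ℍ → ℍ) : Prop :=
  ∀ q ∈ quatBall, sliceMul (sliceConj f) f q ≠ 0

/-- The slice regular inverse `f^{-⋆} = (f^c ⋆ f)⁻¹ f^c`. -/
def sliceInv (f : ℍ → ℍ) : ℍ → ℍ :=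
  fun q => (sliceMul (sliceConj f) f q)⁻¹ * sliceConj f q

/-- Positive definite quaternionic matrices. For Hermitian `P` the number `x* P x` is real. -/
def QuatPosDef {n : ℕ} (P : Matrix (Fin n) (Fin n) ℍ) : Prop :=
  P.IsHermitian ∧ ∀ x : Fin n → ℍ, x ≠ 0 → 0 < (star x ⬝ᵥ (P *ᵥ x)).re

/-- The Pick matrix `P_{ij} = ∑_k p_i^k (1 - s_i \bar s_j) \bar p_j^k`. -/
def pickMatrix {n : ℕ} (p s : Fin n → ℍ) : Matrix (Fin n) (Fin n) ℍ :=
  Matrix.of fun i j => ∑' k : ℕ, p i ^ k * (1 - s i * star (s j)) * star (p j) ^ k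

/-- The `2 × n` matrix with rows `E*` and `N*`, where `E = (1, …, 1)ᵀ`, `N = (s_1, …, s_n)ᵀ`. -/
def rowsEN {n : ℕ} (s : Fin n → ℍ) : Matrix (Fin 2) (Fin n) ℍ :=
  Matrix.of ![fun _ => 1, fun j => star (s j)]

/-- The `n × 2` matrix `[E  -N]`. -/
def colsEN {n : ℕ} (s : Fin n → ℍ) : Matrix (Fin n) (Fin 2) ℍ :=
  Matrix.of fun i => ![1, -s i]

/-- `Θ(q) = I + (q - 1) ∑_k q^k [E*; N*] T*^k P⁻¹ (I - T)⁻¹ [E  -N]` with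
`T = diag (p_1, …, p_n)` and `P` the Pick matrix. `Ring.inverse` is the two-sided inverse in the
(noncommutative) matrix ring; scalars act by multiplication of the entries from the left. -/
def thetaMatrix {n : ℕ} (p s : Fin n → ℍ) (q : ℍ) : Matrix (Fin 2) (Fin 2) ℍ :=
  1 + (q - 1) • ∑' k : ℕ, q ^ k •
    (rowsEN s * (Matrix.diagonal p)ᴴ ^ k * Ring.inverse (pickMatrix p s) *
      Ring.inverse (1 - Matrix.diagonal p) * colsEN s)

/-- `S` solves the Nevanlinna-Pick problem with nodes `p_i` and target values `s_i`. -/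
def SolvesNP {n : ℕ} (p s : Fin n → ℍ) (S : ℍ → ℍ) : Prop :=
  SliceSchur S ∧ ∀ i, S (p i) = s i

/-- The entry `Θ_{ij}` as a function. -/
def thetaEntry {n : ℕ} (p s : Fin n → ℍ) (i j : Fin 2) : ℍ → ℍ :=
  fun q => thetaMatrix p s q i j

/-- The numerator `Θ₁₁ ⋆ 𝓔 + Θ₁₂`. -/
def lftNum {n : ℕ} (p s : Fin n → ℍ) (e : ℍ → ℍ) : ℍ → ℍ :=
  fun q => sliceMul (thetaEntry p s 0 0) e q + thetaEntry p s 0 1 q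

/-- The denominator `Θ₂₁ ⋆ 𝓔 + Θ₂₂`. -/
def lftDen {n : ℕ} (p s : Fin n → ℍ) (e : ℍ → ℍ) : ℍ → ℍ :=
  fun q => sliceMul (thetaEntry p s 1 0) e q + thetaEntry p s 1 1 q

end

/-! The argument replaces functions by their Taylor series and works in the ring of formal power
series over `ℍ`, whose product is the ⋆-product. Restricted to a slice, a slice regular function is
holomorphic, so it is the sum of its Taylor series on the ball (`SliceRegularOn.hasSum`).
Conversely, convergent series are slice regular. The bound |f| ≤ 1 then means that left
multiplication by the series is a contraction of ℓ². Since multiplication is causal, this can be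
tested on the coefficients 0, …, N for every N (`Contractive`), where arbitrary formal series are
allowed and no convergence is needed. The two implications are `SliceSchur.contractive` and
`Contractive.norm_sliceEval_le`.

Θ is the transfer function of a state space system. From the previous state ξ and inputs u₁, u₂, put
v = P⁻¹(I − T)⁻¹(E u₁ − N u₂) and η = ξ − v. The next state is T*η + v, and the outputs are y₁ = u₁
+ E*η, y₂ = u₂ + N*η. The Stein identity P − TPT* = EE* − NN* has two consequences. One is an energy
balance: x_N* P x_N = ‖u₁‖² − ‖u₂‖² − ‖y₁‖² + ‖y₂‖² in truncated norms (`Trajectory.energy`). The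
other is the divided difference formula (X − p_i)(Px)_i = y₁ − s_i y₂ (`Trajectory.interpolation`).

If 𝓔 is contractive, feed in u₁ = 𝓔g and u₂ = g. The balance gives ‖y₁‖ ≤ ‖y₂‖ and bounds the final
state by ‖y₂‖. Because |p_i| < 1, the divided difference formula is a stable recursion backwards in
time, so all states, and hence u₂, are bounded by a constant times ‖y₂‖, uniformly in N. This makes
the denominator invertible with bounded inverse coefficients. The quotient is contractive, and the
divided difference formula gives its values s_i at the nodes (`exists_inverse_lft`).

If S is a contractive solution, the divided differences of S at the nodes determine states, and the
system equations can be solved for inputs a, b that produce the outputs S and 1. Extending g past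
index N by a free response of the system and using that S is a contraction yields the fundamental
inequality x_N* P x_N + ‖Sg‖² ≤ ‖g‖², where x_N is now the N-th coefficient of xg. Compared with the
energy balance it says ‖ag‖ ≤ ‖bg‖, so 𝓔 = ab⁻¹ is contractive and reproduces S
(`exists_lft_of_interpolation`). -/

/-! ### Convergent power series and Taylor coefficients -/

open PowerSeries in
/-- The coefficients of `a` are such that `∑ p ^ k a_k` converges absolutely on the unit ball. -/
def ConvergesOnBall (a : PowerSeries ℍ) : Prop :=
  ∀ r : ℝ, 0 ≤ r → r < 1 → Summable fun k => ‖coeff k a‖ * r ^ k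

/-- The Taylor coefficients of a convergent power series of a real variable. -/
theorem iteratedDeriv_eq_of_hasSum {E : Type*} [NormedAddCommGroup E] [NormedSpace ℝ E]
    [CompleteSpace E] {g : ℝ → E} {a : ℕ → E} {r : ℝ} (hr : 0 < r)
    (h : ∀ x : ℝ, |x| < r → HasSum (fun k => x ^ k • a k) (g x)) (k : ℕ) :
    ((k.factorial : ℝ)⁻¹) • iteratedDeriv k g 0 = a k := by
  let p : FormalMultilinearSeries ℝ ℝ E := fun n =>
    ContinuousMultilinearMap.mkPiRing ℝ (Fin n) (a n)
  have hrad : ENNReal.ofReal r ≤ p.radius := by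
    refine ENNReal.le_of_forall_nnreal_lt fun s hs => ?_
    have hs' : (s : ℝ) < r := by
      rw [ENNReal.ofReal, ENNReal.coe_lt_coe] at hs
      have := NNReal.coe_lt_coe.2 hs
      rwa [Real.coe_toNNReal _ hr.le] at this
    have h1 := (h s (by rwa [abs_of_nonneg (NNReal.coe_nonneg s)])).summable.tendsto_atTop_zero.norm
    refine p.le_radius_of_tendsto (l := 0) ?_
    simpa [p, ContinuousMultilinearMap.norm_mkPiRing, norm_smul, mul_comm] using h1
  have hp : HasFPowerSeriesOnBall g p 0 (ENNReal.ofReal r) := by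
    refine ⟨hrad, by simpa using hr, fun {y} hy => ?_⟩
    have hy' : |y| < r := by
      rw [Metric.mem_eball, edist_zero_right, ← ofReal_norm,
        ENNReal.ofReal_lt_ofReal_iff hr] at hy
      simpa using hy
    simpa [p] using h y hy'
  have := hp.factorial_smul 1 k
  rw [iteratedDeriv_eq_iteratedFDeriv]
  rw [← this]
  simp [p, ← Nat.cast_smul_eq_nsmul ℝ, smul_smul, Nat.factorial_ne_zero]

theorem ConvergesOnBall.summable_norm {a : PowerSeries ℍ} (ha : ConvergesOnBall a) {q : ℍ}
    (hq : q ∈ quatBall) : Summable fun k => ‖q ^ k * PowerSeries.coeff k a‖ := by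
  have := ha ‖q‖ (norm_nonneg _) (by simpa [quatBall] using hq)
  simpa [norm_mul, norm_pow, mul_comm] using this

theorem ConvergesOnBall.summable {a : PowerSeries ℍ} (ha : ConvergesOnBall a) {q : ℍ}
    (hq : q ∈ quatBall) : Summable fun k => q ^ k * PowerSeries.coeff k a :=
  (ha.summable_norm hq).of_norm

theorem ConvergesOnBall.hasSum {a : PowerSeries ℍ} (ha : ConvergesOnBall a) {q : ℍ}
    (hq : q ∈ quatBall) : HasSum (fun k => q ^ k * PowerSeries.coeff k a) (sliceEval a q) :=
  (ha.summable hq).hasSum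

theorem coe_mem_quatBall {x : ℝ} : (x : ℍ) ∈ quatBall ↔ |x| < 1 := by
  simp [quatBall, Quaternion.norm_coe]

/-- A series that converges at the real points of the unit ball converges absolutely there. -/
theorem convergesOnBall_of_summable {a : PowerSeries ℍ}
    (h : ∀ x : ℝ, 0 ≤ x → x < 1 → Summable fun k => (x : ℍ) ^ k * PowerSeries.coeff k a) :
    ConvergesOnBall a := by
  intro r hr0 hr1
  -- Abel's argument: the terms are bounded at a real point t with r < t < 1, so at r they are
  -- dominated by a geometric series of ratio r / t.
  obtain ⟨t, hrt, ht1⟩ := exists_between hr1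
  have ht0 : 0 < t := hr0.trans_lt hrt
  have h1 := (h t ht0.le ht1).tendsto_atTop_zero.norm
  obtain ⟨B, hB⟩ := h1.bddAbove_range
  have hB' : ∀ k, ‖PowerSeries.coeff k a‖ * t ^ k ≤ B := fun k => by
    have := hB ⟨k, rfl⟩
    simpa [norm_mul, norm_pow, Quaternion.norm_coe, abs_of_pos ht0, mul_comm] using this
  refine Summable.of_nonneg_of_le (fun k => by positivity) (fun k => ?_)
    ((summable_geometric_of_lt_one (r := r / t) (by positivity)
      ((div_lt_one ht0).2 hrt)).mul_left B)
  calc ‖PowerSeries.coeff k a‖ * r ^ k = (‖PowerSeries.coeff k a‖ * t ^ k) * (r / t) ^ k := by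
        rw [div_pow]; field_simp
    _ ≤ _ := by gcongr; exact hB' k

theorem sliceTaylor_eq_of_hasSum {f : ℍ → ℍ} {a : PowerSeries ℍ}
    (h : ∀ x : ℝ, |x| < 1 → HasSum (fun k => (x : ℍ) ^ k * PowerSeries.coeff k a) (f x)) :
    sliceTaylor f = a := by
  ext1 k
  rw [sliceTaylor, PowerSeries.coeff_mk]
  refine iteratedDeriv_eq_of_hasSum (a := fun k => PowerSeries.coeff k a) one_pos (fun x hx => ?_) k
  have := h x hx
  simpa only [← Quaternion.coe_pow, Quaternion.coe_mul_eq_smul] using this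

/-- The Taylor series of a function given on the ball by a power series. -/
theorem sliceTaylor_eq {f : ℍ → ℍ} {a : PowerSeries ℍ} (ha : ConvergesOnBall a)
    (h : ∀ q ∈ quatBall, f q = sliceEval a q) : sliceTaylor f = a := by
  refine sliceTaylor_eq_of_hasSum fun x hx => ?_
  rw [h _ (coe_mem_quatBall.2 hx)]
  exact ha.hasSum (coe_mem_quatBall.2 hx)

/-! ### Slices and the equivalence of slice regularity with power series expansion -/

theorem imagUnits_mul_self {I : ℍ} (hI : I ∈ imagUnits) : I * I = -1 := by
  obtain ⟨h0, h1⟩ := hI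
  have h2 : star I = -I := by ext <;> simp [h0]
  have := Quaternion.self_mul_star I
  rw [h2, Quaternion.normSq_eq_norm_mul_self, h1] at this
  simpa [neg_eq_iff_eq_neg] using this

/-- The embedding of `ℂ` onto the slice `ℂ_I`. -/
noncomputable def sliceHom (I : imagUnits) : ℂ →ₐ[ℝ] ℍ :=
  Complex.lift ⟨I, imagUnits_mul_self I.2⟩

theorem sliceHom_mk (I : imagUnits) (z : ℂ) :
    sliceHom I z = (z.re : ℍ) + I * (z.im : ℍ) := by
  simp [sliceHom, Complex.lift, Complex.liftAux_apply]
  rw [← Quaternion.coe_mul_eq_smul, Quaternion.coe_commutes]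

theorem star_sliceHom (I : imagUnits) (z : ℂ) :
    star (sliceHom I z) = sliceHom I (star z) := by
  have h0 := I.2.1
  have h2 : star (I : ℍ) = -I := by ext <;> simp [h0]
  simp [sliceHom_mk, h2, Quaternion.coe_commutes]

theorem norm_sliceHom (I : imagUnits) (z : ℂ) : ‖sliceHom I z‖ = ‖z‖ := by
  have h1 : ((‖sliceHom I z‖ * ‖sliceHom I z‖ : ℝ) : ℍ) = ((‖z‖ * ‖z‖ : ℝ) : ℍ) := by
    rw [← Quaternion.normSq_eq_norm_mul_self, ← Quaternion.self_mul_star, star_sliceHom, ← map_mul]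
    have : z * star z = ((‖z‖ * ‖z‖ : ℝ) : ℂ) := by
      rw [← sq, ← Complex.normSq_eq_norm_sq]; exact Complex.mul_conj z
    rw [this]
    exact (sliceHom I).commutes _
  exact (mul_self_inj (norm_nonneg _) (norm_nonneg _)).1 (Quaternion.coe_injective h1)

theorem imagUnits_nonempty : imagUnits.Nonempty := by
  refine ⟨((Complex.I : ℂ) : ℍ), by simp, ?_⟩
  have : ‖((Complex.I : ℂ) : ℍ)‖ * ‖((Complex.I : ℂ) : ℍ)‖ = 1 := by
    rw [← Quaternion.normSq_eq_norm_mul_self, Quaternion.normSq_def']; simp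
  nlinarith [norm_nonneg ((Complex.I : ℂ) : ℍ)]

theorem exists_sliceHom (q : ℍ) : ∃ (I : imagUnits) (z : ℂ), sliceHom I z = q := by
  by_cases h : q.im = 0
  · obtain ⟨I, hI⟩ := imagUnits_nonempty
    refine ⟨⟨I, hI⟩, q.re, ?_⟩
    rw [sliceHom_mk]
    conv_rhs => rw [← Quaternion.re_add_im q, h]
    simp
  · have hn : ‖q.im‖ ≠ 0 := norm_ne_zero_iff.2 h
    refine ⟨⟨‖q.im‖⁻¹ • q.im, by simp, by rw [norm_smul, norm_inv, norm_norm, inv_mul_cancel₀ hn]⟩,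
      ⟨q.re, ‖q.im‖⟩, ?_⟩
    rw [sliceHom_mk]
    conv_rhs => rw [← Quaternion.re_add_im q]
    simp only [smul_mul_assoc]
    rw [← Quaternion.coe_commutes, Quaternion.coe_mul_eq_smul, smul_smul, inv_mul_cancel₀ hn, one_smul]

/-- `ℍ` as a complex vector space, with `ℂ` acting by left multiplication through `ℂ_I`. -/
noncomputable abbrev sliceNormedSpace (I : imagUnits) : NormedSpace ℂ ℍ :=
  { Module.compHom ℍ (sliceHom I).toRingHom with
    norm_smul_le := fun z q => by
      change ‖sliceHom I z * q‖ ≤ _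
      rw [norm_mul, norm_sliceHom] }

theorem continuous_sliceHom (I : imagUnits) : Continuous (sliceHom I) := by
  simp_rw [funext (sliceHom_mk I)]
  have : Continuous (fun x : ℝ => (x : ℍ)) := Quaternion.continuous_coe
  fun_prop

theorem mem_eball_zero_coe {E : Type*} [SeminormedAddCommGroup E] {y : E} {r : NNReal} :
    y ∈ Metric.eball (0 : E) r ↔ ‖y‖ < r := by
  rw [Metric.mem_eball, edist_zero_right, ← ofReal_norm, ← ENNReal.ofReal_coe_nnreal,
    ENNReal.ofReal_lt_ofReal_iff_of_nonneg (norm_nonneg _)]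

theorem mem_eball_zero_one {E : Type*} [SeminormedAddCommGroup E] {y : E} :
    y ∈ Metric.eball (0 : E) 1 ↔ ‖y‖ < 1 := by
  simpa using mem_eball_zero_coe (y := y) (r := 1)

theorem isOpen_quatBall : IsOpen quatBall := Metric.isOpen_ball

theorem sliceHom_mem_quatBall {I : imagUnits} {z : ℂ} : sliceHom I z ∈ quatBall ↔ ‖z‖ < 1 := by
  simp [quatBall, norm_sliceHom]

theorem sliceHom_re_im (I : imagUnits) (x y : ℝ) :
    sliceHom I ⟨x, y⟩ = (x : ℍ) + I * (y : ℍ) := sliceHom_mk I ⟨x, y⟩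

theorem sliceHom_ofReal (I : imagUnits) (x : ℝ) : sliceHom I (x : ℂ) = (x : ℍ) := by
  simp

/-- The derivatives of a function along the two directions of a slice. -/
theorem DifferentiableAt.hasDerivAt_slice {f : ℍ → ℍ} {I : ℍ} {x y : ℝ}
    (h : DifferentiableAt ℝ f ((x : ℍ) + I * (y : ℍ))) :
    HasDerivAt (fun t : ℝ => f ((t : ℍ) + I * (y : ℍ)))
      (fderiv ℝ f ((x : ℍ) + I * (y : ℍ)) 1) x ∧
    HasDerivAt (fun t : ℝ => f ((x : ℍ) + I * (t : ℍ)))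
      (fderiv ℝ f ((x : ℍ) + I * (y : ℍ)) I) y := by
  have key : ∀ t : ℝ, HasDerivAt (fun t : ℝ => (t : ℍ)) 1 t := fun t => by
    have := (hasDerivAt_id t).smul_const (1 : ℍ)
    simpa [← Quaternion.coe_mul_eq_smul] using this
  constructor
  · exact h.hasFDerivAt.comp_hasDerivAt x ((key x).add_const _)
  · have h2 := ((key y).const_mul I).const_add (x : ℍ)
    rw [mul_one] at h2
    exact h.hasFDerivAt.comp_hasDerivAt y h2

/-- The slice condition is the Cauchy–Riemann equation for the complex structure on `ℍ` given by
left multiplication by I. It makes the real derivative along the slice complex linear, and the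
theory of holomorphic vector-valued functions of one variable becomes available. -/
theorem hasDerivAt_sliceHom_comp {f : ℍ → ℍ} {Ω : Set ℍ} (hΩ : IsOpen Ω)
    (hf : SliceRegularOn f Ω) (I : imagUnits) {z : ℂ} (hz : sliceHom I z ∈ Ω) :
    letI := sliceNormedSpace I
    HasDerivAt (fun w => f (sliceHom I w)) (fderiv ℝ f (sliceHom I z) 1) z := by
  let _ := sliceNormedSpace I
  have hd : DifferentiableAt ℝ f (sliceHom I z) :=
    (hf.1 _ hz).differentiableAt (hΩ.mem_nhds hz)
  have hd' := hd
  rw [sliceHom_mk I z] at hd' hz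
  have hcr := hf.2 I I.2 z.re z.im hz
  obtain ⟨h1, h2⟩ := hd'.hasDerivAt_slice
  rw [h1.deriv, h2.deriv, ← sliceHom_mk I z] at hcr
  have hI : fderiv ℝ f (sliceHom I z) I = I * fderiv ℝ f (sliceHom I z) 1 := by
    have h3 : fderiv ℝ f (sliceHom I z) 1 = -((I : ℍ) * fderiv ℝ f (sliceHom I z) I) :=
      eq_neg_of_add_eq_zero_left hcr
    rw [h3, mul_neg, ← mul_assoc, imagUnits_mul_self I.2]; simp
  let ι : ℂ →L[ℝ] ℍ := ⟨(sliceHom I).toLinearMap, continuous_sliceHom I⟩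
  have hc : HasFDerivAt (fun w => f (sliceHom I w)) ((fderiv ℝ f (sliceHom I z)).comp ι) z :=
    HasFDerivAt.comp z (g := f) (f := sliceHom I) hd.hasFDerivAt (ι.hasFDerivAt)
  rw [hasDerivAt_iff_isLittleO]
  refine hc.isLittleO.congr_left fun w => ?_
  congr 1
  change fderiv ℝ f (sliceHom I z) (sliceHom I (w - z)) =
    sliceHom I (w - z) * fderiv ℝ f (sliceHom I z) 1
  generalize w - z = u
  have hu : sliceHom I u = u.re • (1 : ℍ) + u.im • (I : ℍ) := by
    rw [sliceHom_mk I u, ← Quaternion.coe_commutes, Quaternion.coe_mul_eq_smul,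
      ← Quaternion.coe_mul_eq_smul _ (1 : ℍ), mul_one]
  rw [hu, map_add, map_smul, map_smul, hI, add_mul, smul_mul_assoc, smul_mul_assoc, one_mul]

/-- A slice regular function on the unit ball is the sum of its Taylor series. -/
theorem SliceRegularOn.hasSum {f : ℍ → ℍ} (hf : SliceRegularOn f quatBall) {q : ℍ}
    (hq : q ∈ quatBall) :
    HasSum (fun k => q ^ k * PowerSeries.coeff k (sliceTaylor f)) (f q) := by
  obtain ⟨I, z, rfl⟩ := exists_sliceHom q
  rw [sliceHom_mem_quatBall] at hq
  let _ := sliceNormedSpace I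
  obtain ⟨r, hzr, hr1⟩ := exists_between hq
  have hr0 : 0 < r := (norm_nonneg z).trans_lt hzr
  have hdiff : DifferentiableOn ℂ (fun w => f (sliceHom I w)) (Metric.closedBall 0 r) := by
    intro w hw
    refine (hasDerivAt_sliceHom_comp isOpen_quatBall hf I ?_).differentiableAt.differentiableWithinAt
    rw [sliceHom_mem_quatBall]
    exact (mem_closedBall_zero_iff.1 hw).trans_lt hr1
  lift r to NNReal using hr0.le
  have hps := DifferentiableOn.hasFPowerSeriesOnBall hdiff hr0
  set p := cauchyPowerSeries (fun w => f (sliceHom I w)) 0 r with hp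
  have hsum : ∀ w : ℂ, ‖w‖ < r → HasSum (fun k => (sliceHom I w) ^ k * p.coeff k)
      (f (sliceHom I w)) := by
    intro w hw
    have := hps.hasSum (mem_eball_zero_coe.2 hw)
    rw [zero_add] at this
    have e : ∀ k, (p k fun _ => w) = (sliceHom I w) ^ k * p.coeff k := fun k => by
      rw [FormalMultilinearSeries.apply_eq_prod_smul_coeff, Finset.prod_const, Finset.card_univ,
        Fintype.card_fin, ← map_pow]
      rfl
    rw [funext e] at this
    exact this
  -- The Cauchy coefficients do not depend on the slice or the radius, because they are already
  -- determined on the real axis, which lies in every slice.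
  have hcoeff : ∀ k, PowerSeries.coeff k (sliceTaylor f) = p.coeff k := by
    intro k
    rw [sliceTaylor, PowerSeries.coeff_mk]
    refine iteratedDeriv_eq_of_hasSum (a := fun k => p.coeff k) hr0 (fun x hx => ?_) k
    have := hsum (x : ℂ) (by simpa using hx)
    simpa only [sliceHom_ofReal, ← Quaternion.coe_pow, Quaternion.coe_mul_eq_smul] using this
  simp_rw [hcoeff]
  exact hsum z hzr

theorem SliceRegularOn.convergesOnBall {f : ℍ → ℍ} (hf : SliceRegularOn f quatBall) :
    ConvergesOnBall (sliceTaylor f) :=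
  convergesOnBall_of_summable fun _ h0 h1 =>
    (hf.hasSum (coe_mem_quatBall.2 (by rwa [abs_of_nonneg h0]))).summable

theorem SliceRegularOn.eq_sliceEval {f : ℍ → ℍ} (hf : SliceRegularOn f quatBall) {q : ℍ}
    (hq : q ∈ quatBall) : f q = sliceEval (sliceTaylor f) q :=
  (hf.hasSum hq).tsum_eq.symm

theorem SliceRegularOn.congr {f g : ℍ → ℍ} {Ω : Set ℍ} (hΩ : IsOpen Ω)
    (hf : SliceRegularOn f Ω) (h : ∀ q ∈ Ω, g q = f q) : SliceRegularOn g Ω := by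
  have hev : ∀ q ∈ Ω, g =ᶠ[nhds q] f := fun q hq => by
    filter_upwards [hΩ.mem_nhds hq] with w hw using h w hw
  refine ⟨hf.1.congr h, fun I hI x y hxy => ?_⟩
  have hcoe : Continuous (fun x : ℝ => (x : ℍ)) := Quaternion.continuous_coe
  rw [← hf.2 I hI x y hxy]
  have h1 : (fun t : ℝ => g ((t : ℍ) + I * (y : ℍ))) =ᶠ[nhds x]
      fun t : ℝ => f ((t : ℍ) + I * (y : ℍ)) :=
    (Continuous.tendsto (f := fun t : ℝ => (t : ℍ) + I * (y : ℍ)) (by fun_prop) x).eventually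
      (hev _ hxy)
  have h2 : (fun t : ℝ => g ((x : ℍ) + I * (t : ℍ))) =ᶠ[nhds y]
      fun t : ℝ => f ((x : ℍ) + I * (t : ℍ)) :=
    (Continuous.tendsto (f := fun t : ℝ => (x : ℍ) + I * (t : ℍ)) (by fun_prop) y).eventually
      (hev _ hxy)
  rw [h1.deriv_eq, h2.deriv_eq]

/-- The formal multilinear series `∑ q ^ k a_k`. -/
noncomputable def rightCoeffSeries (a : PowerSeries ℍ) : FormalMultilinearSeries ℝ ℍ ℍ := fun k =>
  ((ContinuousLinearMap.mul ℝ ℍ).flip (PowerSeries.coeff k a)).compContinuousMultilinearMap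
    (ContinuousMultilinearMap.mkPiAlgebraFin ℝ k ℍ)

theorem rightCoeffSeries_apply (a : PowerSeries ℍ) (k : ℕ) (q : ℍ) :
    rightCoeffSeries a k (fun _ => q) = q ^ k * PowerSeries.coeff k a := by
  simp [rightCoeffSeries, ContinuousMultilinearMap.mkPiAlgebraFin_apply]

theorem norm_rightCoeffSeries_le (a : PowerSeries ℍ) (k : ℕ) :
    ‖rightCoeffSeries a k‖ ≤ ‖PowerSeries.coeff k a‖ := by
  refine (ContinuousLinearMap.norm_compContinuousMultilinearMap_le _ _).trans ?_
  rw [ContinuousMultilinearMap.norm_mkPiAlgebraFin, mul_one]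
  exact (ContinuousLinearMap.le_opNorm _ _).trans (by
    rw [ContinuousLinearMap.opNorm_flip]
    exact mul_le_of_le_one_left (norm_nonneg _) (ContinuousLinearMap.opNorm_mul_le ℝ ℍ))

theorem ConvergesOnBall.differentiableOn {a : PowerSeries ℍ} (ha : ConvergesOnBall a) :
    DifferentiableOn ℝ (sliceEval a) quatBall := by
  have hps : HasFPowerSeriesOnBall (sliceEval a) (rightCoeffSeries a) 0 1 := by
    refine ⟨?_, one_pos, fun {y} hy => ?_⟩
    · refine ENNReal.le_of_forall_nnreal_lt fun s hs => ?_
      refine FormalMultilinearSeries.le_radius_of_summable_norm _ ?_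
      refine Summable.of_nonneg_of_le (fun k => by positivity) (fun k => ?_)
        (ha s s.2 (by exact_mod_cast hs))
      gcongr
      exact norm_rightCoeffSeries_le a k
    · simp_rw [rightCoeffSeries_apply, zero_add]
      refine ha.hasSum ?_
      simpa [quatBall] using mem_eball_zero_one.1 hy
  have := hps.differentiableOn
  intro q hq
  refine (this.differentiableAt ((Metric.isOpen_eball).mem_nhds ?_)).differentiableWithinAt
  exact mem_eball_zero_one.2 (by simpa [quatBall] using hq)

theorem ConvergesOnBall.differentiableAt_slice {a : PowerSeries ℍ} (ha : ConvergesOnBall a)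
    (I : imagUnits) {z : ℂ} (hz : ‖z‖ < 1) :
    letI := sliceNormedSpace I
    DifferentiableAt ℂ (fun w => sliceEval a (sliceHom I w)) z := by
  let _ := sliceNormedSpace I
  let p : FormalMultilinearSeries ℂ ℂ ℍ := fun n =>
    ContinuousMultilinearMap.mkPiRing ℂ (Fin n) (PowerSeries.coeff n a)
  have hps : HasFPowerSeriesOnBall (fun w => sliceEval a (sliceHom I w)) p 0 1 := by
    refine ⟨?_, one_pos, fun {y} hy => ?_⟩
    · refine ENNReal.le_of_forall_nnreal_lt fun s hs => ?_
      refine FormalMultilinearSeries.le_radius_of_summable_norm _ ?_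
      simpa [p, ContinuousMultilinearMap.norm_mkPiRing] using ha s s.2 (by exact_mod_cast hs)
    · have := ha.hasSum (sliceHom_mem_quatBall (I := I).2 (mem_eball_zero_one.1 hy))
      rw [zero_add]
      have e : ∀ k, (p k fun _ => y) = (sliceHom I y) ^ k * PowerSeries.coeff k a := fun k => by
        simp only [p, ContinuousMultilinearMap.mkPiRing_apply, Finset.prod_const, Finset.card_univ,
          Fintype.card_fin, ← map_pow]
        rfl
      rw [funext e]
      exact this
  refine hps.differentiableOn.differentiableAt ((Metric.isOpen_eball).mem_nhds ?_)
  exact mem_eball_zero_one.2 hz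

theorem ConvergesOnBall.sliceRegularOn {a : PowerSeries ℍ} (ha : ConvergesOnBall a) :
    SliceRegularOn (sliceEval a) quatBall := by
  refine ⟨ha.differentiableOn, fun I hI x y hxy => ?_⟩
  let _ := sliceNormedSpace ⟨I, hI⟩
  have hd : DifferentiableAt ℝ (sliceEval a) ((x : ℍ) + I * (y : ℍ)) :=
    ha.differentiableOn.differentiableAt (isOpen_quatBall.mem_nhds hxy)
  obtain ⟨h1, h2⟩ := hd.hasDerivAt_slice
  have hz : ‖(⟨x, y⟩ : ℂ)‖ < 1 := by
    rw [← sliceHom_mem_quatBall (I := ⟨I, hI⟩), sliceHom_re_im]; exact hxy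
  obtain ⟨d, hF⟩ : ∃ d, HasDerivAt (fun w => sliceEval a (sliceHom ⟨I, hI⟩ w)) d ⟨x, y⟩ :=
    ⟨_, (ha.differentiableAt_slice ⟨I, hI⟩ hz).hasDerivAt⟩
  rw [h1.deriv, h2.deriv]
  let ι : ℂ →L[ℝ] ℍ := ⟨(sliceHom ⟨I, hI⟩).toLinearMap, continuous_sliceHom ⟨I, hI⟩⟩
  have hc : HasFDerivAt (fun w => sliceEval a (sliceHom ⟨I, hI⟩ w))
      ((fderiv ℝ (sliceEval a) ((x : ℍ) + I * (y : ℍ))).comp ι) ⟨x, y⟩ := by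
    rw [← sliceHom_re_im ⟨I, hI⟩] at hd ⊢
    exact HasFDerivAt.comp (⟨x, y⟩ : ℂ) (g := sliceEval a) (f := sliceHom ⟨I, hI⟩) hd.hasFDerivAt
      (ι.hasFDerivAt)
  -- The complex derivative d, viewed as the real linear map u ↦ ud, must agree with the restricted
  -- real derivative. Evaluating both at 1 and at i gives the slice equation.
  let δ : ℂ →L[ℝ] ℍ := ((ContinuousLinearMap.mul ℝ ℍ).flip d).comp ι
  have hc' : HasFDerivAt (fun w => sliceEval a (sliceHom ⟨I, hI⟩ w)) δ ⟨x, y⟩ :=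
    .of_isLittleO ((hasDerivAt_iff_isLittleO.1 hF).congr_left fun w => rfl)
  have heq := hc.unique hc'
  have e1 := congrArg (fun T : ℂ →L[ℝ] ℍ => T 1) heq
  have e2 := congrArg (fun T : ℂ →L[ℝ] ℍ => T Complex.I) heq
  have i1 : ι 1 = 1 := map_one (sliceHom ⟨I, hI⟩)
  have i2 : ι Complex.I = I := by
    change sliceHom ⟨I, hI⟩ Complex.I = I
    rw [sliceHom_mk]; simp
  simp only [δ, ContinuousLinearMap.comp_apply, i1, i2, ContinuousLinearMap.flip_apply,
    ContinuousLinearMap.mul_apply', one_mul] at e1 e2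
  rw [e1, e2, ← mul_assoc, imagUnits_mul_self hI]
  simp

/-! ### The ring of convergent series, conjugation and ⋆-inverses -/

open PowerSeries in
theorem ConvergesOnBall.of_bounded {a : PowerSeries ℍ} {K : ℝ} (h : ∀ k, ‖coeff k a‖ ≤ K) :
    ConvergesOnBall a := fun _ h0 h1 =>
  Summable.of_nonneg_of_le (fun _ => by positivity)
    (fun k => mul_le_mul_of_nonneg_right (h k) (pow_nonneg h0 k))
    ((summable_geometric_of_lt_one h0 h1).mul_left K)

theorem ConvergesOnBall.add {a b : PowerSeries ℍ} (ha : ConvergesOnBall a)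
    (hb : ConvergesOnBall b) : ConvergesOnBall (a + b) := fun r h0 h1 =>
  Summable.of_nonneg_of_le (fun _ => by positivity)
    (fun k => by
      rw [map_add, ← add_mul]
      exact mul_le_mul_of_nonneg_right (norm_add_le _ _) (pow_nonneg h0 k))
    ((ha r h0 h1).add (hb r h0 h1))

theorem ConvergesOnBall.neg {a : PowerSeries ℍ} (ha : ConvergesOnBall a) :
    ConvergesOnBall (-a) := fun r h0 h1 => by
  simpa using ha r h0 h1

theorem ConvergesOnBall.sub {a b : PowerSeries ℍ} (ha : ConvergesOnBall a)
    (hb : ConvergesOnBall b) : ConvergesOnBall (a - b) := by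
  rw [sub_eq_add_neg]; exact ha.add hb.neg

theorem convergesOnBall_zero : ConvergesOnBall 0 := .of_bounded (K := 0) fun k => by simp

theorem convergesOnBall_one : ConvergesOnBall 1 :=
  .of_bounded (K := 1) fun k => by
    rw [PowerSeries.coeff_one]; split_ifs <;> simp

theorem convergesOnBall_C (c : ℍ) : ConvergesOnBall (PowerSeries.C c) :=
  .of_bounded (K := ‖c‖) fun k => by
    rw [PowerSeries.coeff_C]; split_ifs <;> simp

theorem convergesOnBall_X : ConvergesOnBall PowerSeries.X :=
  .of_bounded (K := 1) fun k => by
    rw [PowerSeries.coeff_X]; split_ifs <;> simp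

theorem ConvergesOnBall.sum {ι : Type*} {s : Finset ι} {a : ι → PowerSeries ℍ}
    (h : ∀ i ∈ s, ConvergesOnBall (a i)) : ConvergesOnBall (∑ i ∈ s, a i) := by
  classical
  induction s using Finset.induction_on with
  | empty => simpa using convergesOnBall_zero
  | insert i s hi ih =>
    rw [Finset.sum_insert hi]
    exact (h i (by simp)).add (ih fun j hj => h j (by simp [hj]))

theorem ConvergesOnBall.mul {a b : PowerSeries ℍ} (ha : ConvergesOnBall a)
    (hb : ConvergesOnBall b) : ConvergesOnBall (a * b) := fun r h0 h1 => by
  have h := summable_norm_sum_mul_antidiagonal_of_summable_norm (ha r h0 h1).norm (hb r h0 h1).norm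
  refine Summable.of_nonneg_of_le (fun _ => by positivity) (fun k => ?_) h
  rw [PowerSeries.coeff_mul, Real.norm_of_nonneg (by positivity)]
  refine (mul_le_mul_of_nonneg_right (norm_sum_le _ _) (pow_nonneg h0 k)).trans ?_
  rw [Finset.sum_mul]
  refine Finset.sum_le_sum fun p hp => ?_
  rw [← Finset.HasAntidiagonal.mem_antidiagonal.1 hp, norm_mul, pow_add]
  exact le_of_eq (by ring)

/-- Coefficientwise conjugation. -/
noncomputable def conjSeries (a : PowerSeries ℍ) : PowerSeries ℍ :=
  PowerSeries.mk fun k => star (PowerSeries.coeff k a)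

@[simp] theorem coeff_conjSeries (a : PowerSeries ℍ) (k : ℕ) :
    PowerSeries.coeff k (conjSeries a) = star (PowerSeries.coeff k a) := by
  simp [conjSeries]

theorem conjSeries_conjSeries (a : PowerSeries ℍ) : conjSeries (conjSeries a) = a := by
  ext1 k; simp

theorem conjSeries_mul (a b : PowerSeries ℍ) :
    conjSeries (a * b) = conjSeries b * conjSeries a := by
  ext1 k
  rw [coeff_conjSeries, PowerSeries.coeff_mul, PowerSeries.coeff_mul, star_sum,
    ← Finset.Nat.sum_antidiagonal_swap]
  simp

theorem conjSeries_one : conjSeries 1 = 1 := by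
  ext1 k
  rw [coeff_conjSeries, PowerSeries.coeff_one]
  split_ifs <;> simp

theorem ConvergesOnBall.conjSeries {a : PowerSeries ℍ} (ha : ConvergesOnBall a) :
    ConvergesOnBall (conjSeries a) := fun r h0 h1 => by
  simpa [Quaternion.norm_star] using ha r h0 h1

theorem sliceEval_add {a b : PowerSeries ℍ} (ha : ConvergesOnBall a) (hb : ConvergesOnBall b)
    {q : ℍ} (hq : q ∈ quatBall) : sliceEval (a + b) q = sliceEval a q + sliceEval b q := by
  simp only [sliceEval, map_add, mul_add]
  exact (ha.summable hq).tsum_add (hb.summable hq)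

theorem sliceEval_C (c q : ℍ) : sliceEval (PowerSeries.C c) q = c := by
  rw [sliceEval, tsum_eq_single 0]
  · simp
  · intro k hk; simp [PowerSeries.coeff_C, hk]

theorem sliceEval_one (q : ℍ) : sliceEval 1 q = 1 := by
  simpa using sliceEval_C 1 q

theorem sliceEval_X (q : ℍ) : sliceEval PowerSeries.X q = q := by
  rw [sliceEval, tsum_eq_single 1]
  · simp
  · intro k hk; simp [PowerSeries.coeff_X, hk]

theorem HasSum.sum_antidiagonal {G : ℕ × ℕ → ℍ} {x : ℍ} (h : HasSum G x) :
    HasSum (fun k => ∑ p ∈ Finset.HasAntidiagonal.antidiagonal k, G p) x :=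
  ((Finset.HasAntidiagonal.sigmaAntidiagonalEquivProd (A := ℕ)).hasSum_iff.2 h).sigma fun k =>
    (Finset.HasAntidiagonal.antidiagonal k).hasSum G

/-- The value of a product of power series. -/
theorem hasSum_sliceEval_mul {a b : PowerSeries ℍ} (ha : ConvergesOnBall a)
    (hb : ConvergesOnBall b) {q : ℍ} (hq : q ∈ quatBall) :
    HasSum (fun j => q ^ j * sliceEval a q * PowerSeries.coeff j b) (sliceEval (a * b) q) := by
  have hq' : ‖q‖ < 1 := by simpa [quatBall] using hq
  -- The double family is absolutely summable. Summing it along antidiagonals gives the product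
  -- series, and summing it along rows gives the terms q^j a(q) b_j.
  have hG : Summable fun p : ℕ × ℕ =>
      q ^ p.1 * (q ^ p.2 * PowerSeries.coeff p.2 a) * PowerSeries.coeff p.1 b := by
    refine Summable.of_norm ?_
    have h := Summable.mul_of_nonneg (hb ‖q‖ (norm_nonneg _) hq') (ha ‖q‖ (norm_nonneg _) hq')
      (fun k => by positivity) (fun k => by positivity)
    refine h.congr fun p => ?_
    simp only [norm_mul, norm_pow]
    ring
  obtain ⟨x, hx⟩ := hG
  have h1 : sliceEval (a * b) q = x := by
    rw [sliceEval, ← (HasSum.sum_antidiagonal hx).tsum_eq]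
    refine tsum_congr fun k => ?_
    rw [PowerSeries.coeff_mul, Finset.mul_sum, ← Finset.Nat.sum_antidiagonal_swap]
    refine Finset.sum_congr rfl fun p hp => ?_
    rw [← Finset.HasAntidiagonal.mem_antidiagonal.1 hp, pow_add]
    simp only [Prod.fst_swap, Prod.snd_swap, mul_assoc]
  rw [h1]
  refine HasSum.prod_fiberwise hx (g := fun j => q ^ j * sliceEval a q * PowerSeries.coeff j b) ?_
  intro j
  have h2 := ((ha.hasSum hq).mul_left (q ^ j)).mul_right (PowerSeries.coeff j b)
  exact h2

/-- If the coefficients of `a` are real, evaluation is multiplicative. -/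
theorem sliceEval_mul_of_real {a b : PowerSeries ℍ} (ha : ConvergesOnBall a)
    (hb : ConvergesOnBall b) (hreal : conjSeries a = a) {q : ℍ} (hq : q ∈ quatBall) :
    sliceEval (a * b) q = sliceEval a q * sliceEval b q := by
  have hc : ∀ k, ∃ x : ℝ, PowerSeries.coeff k a = (x : ℍ) := fun k => by
    have := congrArg (PowerSeries.coeff k) hreal
    rw [coeff_conjSeries] at this
    exact ⟨_, Quaternion.star_eq_self.1 this⟩
  -- With real coefficients a(q) is a limit of real polynomials in q, so it commutes with q and can
  -- be pulled out of every term q^j a(q) b_j.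
  have hcomm : Commute q (sliceEval a q) := by
    refine Commute.tsum_right _ fun k => ?_
    obtain ⟨x, hx⟩ := hc k
    rw [hx]
    exact ((Commute.refl q).pow_right k).mul_right (Quaternion.coe_commute x q).symm
  rw [← (hasSum_sliceEval_mul ha hb hq).tsum_eq]
  simp_rw [((hcomm.pow_left _).eq), mul_assoc]
  exact tsum_mul_left

theorem sliceEval_X_sub_one_mul {b : PowerSeries ℍ} (hb : ConvergesOnBall b) {q : ℍ}
    (hq : q ∈ quatBall) :
    sliceEval ((PowerSeries.X - 1) * b) q = (q - 1) * sliceEval b q := by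
  rw [sliceEval_mul_of_real (convergesOnBall_X.sub convergesOnBall_one) hb _ hq]
  · rw [sub_eq_add_neg, sliceEval_add convergesOnBall_X convergesOnBall_one.neg hq, sliceEval_X,
      show (-1 : PowerSeries ℍ) = PowerSeries.C (-1) by simp, sliceEval_C, sub_eq_add_neg]
  · ext1 k
    rw [coeff_conjSeries, map_sub, PowerSeries.coeff_one, PowerSeries.coeff_X]
    split_ifs <;> simp

/-- Self-conjugate means that the coefficients of a^c ⋆ a are real. This is why evaluation is
multiplicative on this factor and why the pointwise reciprocal in the definition of f^{-⋆} is
meaningful. -/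
theorem conjSeries_mul_self_real (a : PowerSeries ℍ) :
    conjSeries (conjSeries a * a) = conjSeries a * a := by
  rw [conjSeries_mul, conjSeries_conjSeries]

section Functions

variable {f : ℍ → ℍ} {a b : PowerSeries ℍ}

theorem sliceConj_eq (hf : sliceTaylor f = a) : sliceConj f = sliceEval (conjSeries a) := by
  rw [sliceConj, hf, conjSeries]

theorem sliceMul_sliceConj_eq (ha : ConvergesOnBall a) (hf : sliceTaylor f = a) :
    sliceMul (sliceConj f) f = sliceEval (conjSeries a * a) := by
  rw [sliceMul, sliceConj_eq hf, sliceTaylor_eq ha.conjSeries fun _ _ => rfl, hf]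

/-- The series b ⋆ b^c inverts a^c ⋆ a, and evaluation respects this product since the first factor
is real. -/
theorem sliceEval_conj_mul_self_ne_zero (ha : ConvergesOnBall a) (hb : ConvergesOnBall b)
    (hab : a * b = 1) (hba : b * a = 1) {q : ℍ} (hq : q ∈ quatBall) :
    sliceEval (conjSeries a * a) q ≠ 0 := by
  have h : (conjSeries a * a) * (b * conjSeries b) = 1 := by
    rw [mul_assoc, ← mul_assoc a, hab, one_mul, ← conjSeries_mul, hba, conjSeries_one]
  have h2 := sliceEval_mul_of_real (ha.conjSeries.mul ha) (hb.mul hb.conjSeries)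
    (conjSeries_mul_self_real a) hq
  rw [h, sliceEval_one] at h2
  exact left_ne_zero_of_mul (h2 ▸ one_ne_zero)

theorem sliceInvertible_of_mul_eq_one (ha : ConvergesOnBall a) (hb : ConvergesOnBall b)
    (hab : a * b = 1) (hba : b * a = 1) (hf : sliceTaylor f = a) : SliceInvertible f := by
  intro q hq
  rw [sliceMul_sliceConj_eq ha hf]
  exact sliceEval_conj_mul_self_ne_zero ha hb hab hba hq

/-- Evaluating (a^c a) b = a^c with a real first factor and dividing by its nonzero value identifies
f^{-⋆} with the inverse series b. -/
theorem sliceInv_eq (ha : ConvergesOnBall a) (hb : ConvergesOnBall b)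
    (hab : a * b = 1) (hba : b * a = 1) (hf : sliceTaylor f = a) {q : ℍ} (hq : q ∈ quatBall) :
    sliceInv f q = sliceEval b q := by
  have h0 := sliceEval_conj_mul_self_ne_zero ha hb hab hba hq
  have h2 := sliceEval_mul_of_real (ha.conjSeries.mul ha) hb (conjSeries_mul_self_real a) hq
  rw [mul_assoc, hab, mul_one] at h2
  rw [sliceInv, sliceMul_sliceConj_eq ha hf, sliceConj_eq hf, h2, inv_mul_cancel_left₀ h0]

end Functions

/-- A power series over a division ring with nonzero constant term has a two-sided inverse. -/
theorem exists_inverse_of_constantCoeff_ne_zero {R : Type*} [DivisionRing R] {a : PowerSeries R}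
    (h : PowerSeries.constantCoeff a ≠ 0) : ∃ b : PowerSeries R, a * b = 1 ∧ b * a = 1 :=
  ⟨PowerSeries.invOfUnit a (Units.mk0 _ h), PowerSeries.mul_invOfUnit _ _ rfl,
    PowerSeries.invOfUnit_mul _ _ rfl⟩

/-! ### Truncated ℓ² norms and contractive multipliers -/

/-- The `ℓ²` norm of the coefficients of index at most `N`. -/
noncomputable def truncNorm (N : ℕ) (a : PowerSeries ℍ) : ℝ :=
  ‖(WithLp.toLp 2 fun k : Fin (N + 1) => PowerSeries.coeff k a : PiLp 2 fun _ => ℍ)‖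

theorem truncNorm_nonneg (N : ℕ) (a : PowerSeries ℍ) : 0 ≤ truncNorm N a := norm_nonneg _

theorem truncNorm_sq (N : ℕ) (a : PowerSeries ℍ) :
    truncNorm N a ^ 2 = ∑ k ∈ Finset.range (N + 1), ‖PowerSeries.coeff k a‖ ^ 2 := by
  rw [truncNorm, PiLp.norm_sq_eq_of_L2,
    ← Fin.sum_univ_eq_sum_range fun k => ‖PowerSeries.coeff k a‖ ^ 2]

theorem truncNorm_add_le (N : ℕ) (a b : PowerSeries ℍ) :
    truncNorm N (a + b) ≤ truncNorm N a + truncNorm N b := by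
  refine le_trans (le_of_eq ?_) (norm_add_le _ _)
  rw [truncNorm, ← WithLp.toLp_add]
  congr 2

theorem truncNorm_neg (N : ℕ) (a : PowerSeries ℍ) : truncNorm N (-a) = truncNorm N a := by
  rw [← sq_eq_sq₀ (truncNorm_nonneg _ _) (truncNorm_nonneg _ _), truncNorm_sq, truncNorm_sq]
  simp

theorem truncNorm_sub_le (N : ℕ) (a b : PowerSeries ℍ) :
    truncNorm N (a - b) ≤ truncNorm N a + truncNorm N b := by
  rw [sub_eq_add_neg, ← truncNorm_neg N b]
  exact truncNorm_add_le _ _ _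

theorem truncNorm_zero (N : ℕ) : truncNorm N 0 = 0 := by
  rw [← sq_eq_sq₀ (truncNorm_nonneg _ _) le_rfl, truncNorm_sq]
  simp

theorem truncNorm_sum_le {ι : Type*} (N : ℕ) (s : Finset ι) (a : ι → PowerSeries ℍ) :
    truncNorm N (∑ i ∈ s, a i) ≤ ∑ i ∈ s, truncNorm N (a i) :=
  Finset.le_sum_of_subadditive _ (truncNorm_zero N).le (truncNorm_add_le N) _ _

theorem truncNorm_C_mul (N : ℕ) (c : ℍ) (a : PowerSeries ℍ) :
    truncNorm N (PowerSeries.C c * a) = ‖c‖ * truncNorm N a := by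
  rw [← sq_eq_sq₀ (truncNorm_nonneg _ _) (by have := truncNorm_nonneg N a; positivity),
    mul_pow, truncNorm_sq, truncNorm_sq, Finset.mul_sum]
  simp [mul_pow]

theorem truncNorm_X_mul_le (N : ℕ) (a : PowerSeries ℍ) :
    truncNorm N (PowerSeries.X * a) ≤ truncNorm N a := by
  refine (sq_le_sq₀ (truncNorm_nonneg _ _) (truncNorm_nonneg _ _)).1 ?_
  rw [truncNorm_sq, truncNorm_sq, Finset.sum_range_succ', Finset.sum_range_succ]
  simp [PowerSeries.coeff_succ_X_mul]

theorem truncNorm_one (N : ℕ) : truncNorm N 1 = 1 := by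
  rw [← sq_eq_sq₀ (truncNorm_nonneg _ _) zero_le_one, truncNorm_sq, Finset.sum_range_succ']
  simp [PowerSeries.coeff_one]

theorem norm_coeff_le_truncNorm {N k : ℕ} (hk : k ≤ N) (a : PowerSeries ℍ) :
    ‖PowerSeries.coeff k a‖ ≤ truncNorm N a := by
  refine (sq_le_sq₀ (norm_nonneg _) (truncNorm_nonneg _ _)).1 ?_
  rw [truncNorm_sq]
  exact Finset.single_le_sum (f := fun k => ‖PowerSeries.coeff k a‖ ^ 2)
    (fun _ _ => by positivity) (by simpa [Nat.lt_succ_iff] using hk)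

theorem truncNorm_zero_left (a : PowerSeries ℍ) :
    truncNorm 0 a = ‖PowerSeries.coeff 0 a‖ := by
  rw [← sq_eq_sq₀ (truncNorm_nonneg _ _) (norm_nonneg _), truncNorm_sq]
  simp

theorem truncNorm_congr {N : ℕ} {a b : PowerSeries ℍ}
    (h : ∀ k ≤ N, PowerSeries.coeff k a = PowerSeries.coeff k b) :
    truncNorm N a = truncNorm N b := by
  rw [truncNorm, truncNorm]
  congr 2
  ext1 k
  exact h k (Nat.lt_succ_iff.1 k.2)

/-- Multiplication by `a` is contractive on every truncation. -/
def Contractive (a : PowerSeries ℍ) : Prop :=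
  ∀ (N : ℕ) (g : PowerSeries ℍ), truncNorm N (a * g) ≤ truncNorm N g

theorem Contractive.norm_coeff_le {a : PowerSeries ℍ} (ha : Contractive a) (k : ℕ) :
    ‖PowerSeries.coeff k a‖ ≤ 1 := by
  have := ha k 1
  rw [mul_one, truncNorm_one] at this
  exact (norm_coeff_le_truncNorm le_rfl a).trans this

theorem Contractive.convergesOnBall {a : PowerSeries ℍ} (ha : Contractive a) :
    ConvergesOnBall a := .of_bounded ha.norm_coeff_le

/-- The multiplier is tested on the Szegő kernel at q scaled by the conjugate of c = a(q). With t =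
|q|², (ag)(q) = |c|²/(1 − t), while Cauchy–Schwarz and contractivity bound it by |c|/(1 − t). Hence
|c|² ≤ |c|. -/
theorem Contractive.norm_sliceEval_le {a : PowerSeries ℍ} (ha : Contractive a) {q : ℍ}
    (hq : q ∈ quatBall) : ‖sliceEval a q‖ ≤ 1 := by
  have hq' : ‖q‖ < 1 := by simpa [quatBall] using hq
  have ht : ‖q‖ ^ 2 < 1 := by nlinarith [norm_nonneg q]
  set t := ‖q‖ ^ 2 with ht_def
  have ht0 : 0 ≤ t := by positivity
  set c := sliceEval a q with hc
  let g : PowerSeries ℍ := PowerSeries.mk fun j => star c * star q ^ j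
  have hgn : ∀ j, ‖PowerSeries.coeff j g‖ = ‖c‖ * ‖q‖ ^ j := fun j => by
    simp [g]
  have hg : ConvergesOnBall g := .of_bounded (K := ‖c‖) fun j => by
    rw [hgn]
    exact mul_le_of_le_one_right (norm_nonneg _) (pow_le_one₀ (norm_nonneg _) hq'.le)
  have hgeom : ∀ N, ∑ k ∈ Finset.range (N + 1), t ^ k ≤ (1 - t)⁻¹ := fun N => by
    rw [← tsum_geometric_of_lt_one ht0 ht]
    exact (summable_geometric_of_lt_one ht0 ht).sum_le_tsum _ fun _ _ => by positivity
  have hgt : ∀ N, truncNorm N g ^ 2 ≤ ‖c‖ ^ 2 * (1 - t)⁻¹ := fun N => by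
    rw [truncNorm_sq]
    refine le_trans (le_of_eq ?_) (mul_le_mul_of_nonneg_left (hgeom N) (by positivity))
    rw [Finset.mul_sum]
    refine Finset.sum_congr rfl fun k _ => ?_
    rw [hgn, mul_pow, ht_def, ← pow_mul, ← pow_mul, mul_comm k]
  have h1t : 0 < (1 - t)⁻¹ := inv_pos.2 (by linarith)
  have hval : sliceEval (a * g) q = ((‖c‖ ^ 2 * (1 - t)⁻¹ : ℝ) : ℍ) := by
    have h1 := hasSum_sliceEval_mul ha.convergesOnBall hg hq
    have h2 : ∀ j, q ^ j * c * PowerSeries.coeff j g = ((‖c‖ ^ 2 * t ^ j : ℝ) : ℍ) := fun j => by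
      simp only [g, PowerSeries.coeff_mk]
      rw [mul_assoc, ← mul_assoc c, Quaternion.self_mul_star, ← mul_assoc,
        ← Quaternion.coe_commutes, mul_assoc, ← star_pow, Quaternion.self_mul_star,
        ← Quaternion.coe_mul, Quaternion.normSq_eq_norm_mul_self,
        Quaternion.normSq_eq_norm_mul_self, norm_pow, ht_def]
      congr 1
      ring
    rw [← hc] at h1
    rw [funext h2] at h1
    refine h1.unique (Quaternion.hasSum_coe.2 ?_)
    exact (hasSum_geometric_of_lt_one ht0 ht).mul_left _
  have hbound : ∀ N, ‖∑ k ∈ Finset.range (N + 1), q ^ k * PowerSeries.coeff k (a * g)‖ ≤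
      ‖c‖ * (1 - t)⁻¹ := by
    intro N
    refine (norm_sum_le _ _).trans ?_
    refine abs_le_of_sq_le_sq' ?_ (by positivity) |>.2
    simp_rw [norm_mul, norm_pow]
    refine (Finset.sum_mul_sq_le_sq_mul_sq _ _ _).trans ?_
    rw [← truncNorm_sq]
    have h1 : ∑ k ∈ Finset.range (N + 1), (‖q‖ ^ k) ^ 2 ≤ (1 - t)⁻¹ := by
      refine le_trans (le_of_eq (Finset.sum_congr rfl fun k _ => ?_)) (hgeom N)
      rw [ht_def, ← pow_mul, ← pow_mul, mul_comm]
    have h2 : truncNorm N (a * g) ^ 2 ≤ ‖c‖ ^ 2 * (1 - t)⁻¹ :=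
      (pow_le_pow_left₀ (truncNorm_nonneg _ _) (ha N g) 2).trans (hgt N)
    calc _ ≤ (1 - t)⁻¹ * (‖c‖ ^ 2 * (1 - t)⁻¹) := mul_le_mul h1 h2 (by positivity) h1t.le
      _ = _ := by ring
  have hlim := (((ha.convergesOnBall.mul hg).hasSum hq).tendsto_sum_nat.comp
    (Filter.tendsto_add_atTop_nat 1)).norm
  have hle := le_of_tendsto hlim (Filter.Eventually.of_forall hbound)
  rw [hval, Quaternion.norm_coe, Real.norm_of_nonneg (by positivity)] at hle
  have h3 := le_of_mul_le_mul_right hle h1t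
  by_contra hcon
  rw [not_le] at hcon
  nlinarith

theorem Contractive.sliceSchur {a : PowerSeries ℍ} (ha : Contractive a) :
    SliceSchur (sliceEval a) :=
  ⟨ha.convergesOnBall.sliceRegularOn, fun _ hq => ha.norm_sliceEval_le hq⟩

/-! ### Bounded slice regular functions are contractive multipliers -/

/-- The left side is the squared norm of (α + iβ)(A + iB) in ℍ ⊗ ℂ, with i a central imaginary unit.
Only the last term on the right obstructs multiplicativity of this norm. -/
theorem norm_sq_sub_add_norm_sq_add (α β A B : ℍ) :
    ‖α * A - β * B‖ ^ 2 + ‖α * B + β * A‖ ^ 2 =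
      (‖α‖ ^ 2 + ‖β‖ ^ 2) * (‖A‖ ^ 2 + ‖B‖ ^ 2) +
        2 * ((star β * α) * (B * star A - A * star B)).re := by
  simp only [sq, ← Quaternion.normSq_eq_norm_mul_self, Quaternion.normSq_def']
  simp
  ring

theorem norm_sq_add_mul (α β I : ℍ) (hI : ‖I‖ = 1) :
    ‖α + I * β‖ ^ 2 = ‖α‖ ^ 2 + ‖β‖ ^ 2 + 2 * (I * (β * star α)).re := by
  have h : ‖α + I * β‖ ^ 2 = ‖α‖ ^ 2 + ‖I * β‖ ^ 2 + 2 * (I * (β * star α)).re := by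
    simp only [sq, ← Quaternion.normSq_eq_norm_mul_self, Quaternion.normSq_def']
    simp
    ring
  rw [h, norm_mul, hI, one_mul]

theorem Quaternion.norm_sq_eq_re_sq_add (q : ℍ) : ‖q‖ ^ 2 = q.re ^ 2 + ‖q.im‖ ^ 2 := by
  simp only [sq, ← Quaternion.normSq_eq_norm_mul_self, Quaternion.normSq_def']
  simp
  ring

/-- Both products have the same modulus and the same real part. The supremum over imaginary units
produces one of them and the complexified product the other. -/
theorem norm_im_star_mul (α β : ℍ) : ‖(star β * α).im‖ = ‖(β * star α).im‖ := by
  have h1 := Quaternion.norm_sq_eq_re_sq_add (star β * α)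
  have h2 := Quaternion.norm_sq_eq_re_sq_add (β * star α)
  have h3 : (star β * α).re = (β * star α).re := by simp
  rw [norm_mul, Quaternion.norm_star, h3] at h1
  rw [norm_mul, Quaternion.norm_star] at h2
  rw [← sq_eq_sq₀ (norm_nonneg _) (norm_nonneg _)]
  linarith

/-- The largest value of `‖α + I β‖` over the imaginary units. -/
theorem norm_sq_add_two_mul_le {α β : ℍ} {c : ℝ} (h : ∀ I ∈ imagUnits, ‖α + I * β‖ ≤ c) :
    ‖α‖ ^ 2 + ‖β‖ ^ 2 + 2 * ‖(β * star α).im‖ ≤ c ^ 2 := by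
  have key : ∃ I ∈ imagUnits, (I * (β * star α)).re = ‖(β * star α).im‖ := by
    set w := β * star α
    by_cases hw : w.im = 0
    · obtain ⟨I, hI⟩ := imagUnits_nonempty
      refine ⟨I, hI, ?_⟩
      rw [← Quaternion.re_add_im w, hw]
      simp [hI.1]
    · have hn : ‖w.im‖ ≠ 0 := norm_ne_zero_iff.2 hw
      -- The real part of Iw is largest when I points opposite to the imaginary part of w.
      refine ⟨-(‖w.im‖⁻¹ • w.im), ⟨by simp, ?_⟩, ?_⟩
      · rw [norm_neg, norm_smul, norm_inv, norm_norm, inv_mul_cancel₀ hn]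
      · have h1 : ((w.im) * w).re = -(‖w.im‖ * ‖w.im‖) := by
          rw [← Quaternion.normSq_eq_norm_mul_self, Quaternion.normSq_def']
          simp
          ring
        rw [neg_mul, smul_mul_assoc, Quaternion.re_neg, Quaternion.re_smul, h1]
        simp only [smul_eq_mul]
        field_simp
  obtain ⟨I, hI, hre⟩ := key
  rw [← hre, ← norm_sq_add_mul α β I hI.2]
  exact pow_le_pow_left₀ (norm_nonneg _) (h I hI) 2

theorem Quaternion.re_mul_le_of_re_eq_zero {x w : ℍ} (hw : w.re = 0) :
    (x * w).re ≤ ‖x.im‖ * ‖w‖ := by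
  have h : (x * w).re = (x.im * w).re := by
    conv_lhs => rw [← Quaternion.re_add_im x, add_mul, Quaternion.re_add]
    simp [hw]
  rw [h, ← norm_mul]
  have := Quaternion.norm_sq_eq_re_sq_add (x.im * w)
  exact (abs_le_of_sq_le_sq' (by nlinarith [sq_nonneg ‖(x.im * w).im‖]) (norm_nonneg _)).2

/-- If `α + I β` is bounded by `c` for all imaginary units `I`, then left multiplication by
`α + i β` on the complexified quaternions is bounded by `c`. -/
theorem norm_sq_complexified_mul_le {α β : ℍ} {c : ℝ} (h : ∀ I ∈ imagUnits, ‖α + I * β‖ ≤ c)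
    (A B : ℍ) :
    ‖α * A - β * B‖ ^ 2 + ‖α * B + β * A‖ ^ 2 ≤ c ^ 2 * (‖A‖ ^ 2 + ‖B‖ ^ 2) := by
  rw [norm_sq_sub_add_norm_sq_add]
  have h1 := norm_sq_add_two_mul_le h
  have hw : (B * star A - A * star B).re = 0 := by
    simp
    ring
  have h2 := Quaternion.re_mul_le_of_re_eq_zero (x := star β * α) hw
  rw [norm_im_star_mul] at h2
  -- The factor BA* − AB* is purely imaginary, so it sees only the imaginary part of β*α, and its
  -- norm is at most 2|A||B|. The cross term is therefore absorbed by the bound obtained from the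
  -- best imaginary unit.
  have h3 : ‖B * star A - A * star B‖ ≤ ‖A‖ ^ 2 + ‖B‖ ^ 2 := by
    refine (norm_sub_le _ _).trans ?_
    rw [norm_mul, norm_mul, Quaternion.norm_star, Quaternion.norm_star]
    nlinarith [sq_nonneg (‖A‖ - ‖B‖)]
  nlinarith [mul_le_mul_of_nonneg_left h3 (norm_nonneg (β * star α).im),
    mul_le_mul_of_nonneg_right h1 (by positivity : 0 ≤ ‖A‖ ^ 2 + ‖B‖ ^ 2)]

open MeasureTheory in
theorem integral_cos_nat_sub (j k : ℕ) :
    ∫ θ in (0 : ℝ)..(2 * Real.pi), (Real.cos (j * θ) * Real.cos (k * θ) +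
      Real.sin (j * θ) * Real.sin (k * θ)) = if j = k then 2 * Real.pi else 0 := by
  have h : ∀ θ : ℝ, Real.cos (j * θ) * Real.cos (k * θ) + Real.sin (j * θ) * Real.sin (k * θ) =
      Real.cos (((j : ℝ) - k) * θ) := fun θ => by
    rw [sub_mul, Real.cos_sub]
  simp_rw [h]
  split_ifs with hjk
  · simp [hjk]
  · have hne : ((j : ℝ) - k) ≠ 0 := sub_ne_zero.2 (by exact_mod_cast hjk)
    rw [intervalIntegral.integral_comp_mul_left (fun x => Real.cos x) hne, integral_cos]
    have : ((j : ℝ) - k) * (2 * Real.pi) = ((j : ℤ) - (k : ℤ) : ℤ) * (2 * Real.pi) := by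
      push_cast; ring
    have h2 : Real.sin (((j : ℝ) - k) * (2 * Real.pi)) = 0 := by
      rw [this, ← zero_add (((((j : ℤ) - (k : ℤ) : ℤ)) : ℝ) * (2 * Real.pi)), Real.sin_add_int_mul_two_pi,
        Real.sin_zero]
    simp [h2]

/-- Parseval's identity for trigonometric polynomials with coefficients in a real inner product
space. -/
theorem integral_norm_sq_trig {E : Type*} [NormedAddCommGroup E] [InnerProductSpace ℝ E]
    (M : ℕ) (b : ℕ → E) :
    ∫ θ in (0 : ℝ)..(2 * Real.pi),
      (‖∑ k ∈ Finset.range M, Real.cos (k * θ) • b k‖ ^ 2 +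
        ‖∑ k ∈ Finset.range M, Real.sin (k * θ) • b k‖ ^ 2) =
      2 * Real.pi * ∑ k ∈ Finset.range M, ‖b k‖ ^ 2 := by
  have h : ∀ θ : ℝ, ‖∑ k ∈ Finset.range M, Real.cos (k * θ) • b k‖ ^ 2 +
        ‖∑ k ∈ Finset.range M, Real.sin (k * θ) • b k‖ ^ 2 =
      ∑ j ∈ Finset.range M, ∑ k ∈ Finset.range M,
        (Real.cos (j * θ) * Real.cos (k * θ) + Real.sin (j * θ) * Real.sin (k * θ)) *
          inner ℝ (b j) (b k) := fun θ => by
    rw [← real_inner_self_eq_norm_sq, ← real_inner_self_eq_norm_sq]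
    simp only [sum_inner, inner_sum, real_inner_smul_left, real_inner_smul_right]
    rw [← Finset.sum_add_distrib]
    refine Finset.sum_congr rfl fun j _ => ?_
    rw [← Finset.sum_add_distrib]
    exact Finset.sum_congr rfl fun k _ => by rw [real_inner_comm (b j) (b k)]; ring
  simp_rw [h]
  have hint : ∀ j k : ℕ, IntervalIntegrable (fun θ : ℝ =>
      (Real.cos (j * θ) * Real.cos (k * θ) + Real.sin (j * θ) * Real.sin (k * θ)) *
          inner ℝ (b j) (b k)) MeasureTheory.volume 0 (2 * Real.pi) := fun j k =>
    Continuous.intervalIntegrable (by fun_prop) _ _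
  rw [intervalIntegral.integral_finsetSum fun j _ =>
    Continuous.intervalIntegrable (by fun_prop) _ _, Finset.mul_sum]
  refine Finset.sum_congr rfl fun j hj => ?_
  rw [intervalIntegral.integral_finsetSum fun k _ => hint j k]
  simp_rw [intervalIntegral.integral_mul_const, integral_cos_nat_sub]
  rw [Finset.sum_eq_single j]
  · simp
  · intro k _ hk; simp [hk.symm]
  · intro h; exact absurd hj h

/-- Evaluation of a quaternionic polynomial at `e ^ {iθ}` with values in the complexified
quaternions, written as `2 × 2` matrices. -/
noncomputable def circleEval (θ : ℝ) : Polynomial ℍ →+* Matrix (Fin 2) (Fin 2) ℍ :=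
  Polynomial.eval₂RingHom' (Matrix.scalar (Fin 2))
    !![(Real.cos θ : ℍ), -(Real.sin θ : ℍ); (Real.sin θ : ℍ), (Real.cos θ : ℍ)]
    fun a => by
      refine Matrix.ext fun i j => ?_
      fin_cases i <;> fin_cases j <;>
        simp [Matrix.mul_apply, Fin.sum_univ_two, Matrix.scalar_apply, Quaternion.coe_commutes]

theorem rotation_pow (θ : ℝ) (k : ℕ) :
    !![(Real.cos θ : ℍ), -(Real.sin θ : ℍ); (Real.sin θ : ℍ), (Real.cos θ : ℍ)] ^ k =
      !![(Real.cos (k * θ) : ℍ), -(Real.sin (k * θ) : ℍ);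
        (Real.sin (k * θ) : ℍ), (Real.cos (k * θ) : ℍ)] := by
  induction k with
  | zero =>
    refine Matrix.ext fun i j => ?_
    fin_cases i <;> fin_cases j <;> simp
  | succ k ih =>
    have hk : ((k + 1 : ℕ) : ℝ) * θ = k * θ + θ := by push_cast; ring
    rw [pow_succ, ih, hk, Real.cos_add, Real.sin_add]
    refine Matrix.ext fun i j => ?_
    fin_cases i <;> fin_cases j <;>
      simp [Matrix.mul_apply, Fin.sum_univ_two, sub_eq_add_neg, add_comm]

theorem circleEval_apply (θ : ℝ) {M : ℕ} {a : Polynomial ℍ} (ha : a.natDegree < M) :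
    (circleEval θ a) 0 0 = ∑ k ∈ Finset.range M, Real.cos (k * θ) • a.coeff k ∧
    (circleEval θ a) 1 0 = ∑ k ∈ Finset.range M, Real.sin (k * θ) • a.coeff k ∧
    (circleEval θ a) 0 1 = -∑ k ∈ Finset.range M, Real.sin (k * θ) • a.coeff k ∧
    (circleEval θ a) 1 1 = ∑ k ∈ Finset.range M, Real.cos (k * θ) • a.coeff k := by
  have h : circleEval θ a = ∑ k ∈ Finset.range M, Matrix.scalar (Fin 2) (a.coeff k) *
      !![(Real.cos θ : ℍ), -(Real.sin θ : ℍ); (Real.sin θ : ℍ), (Real.cos θ : ℍ)] ^ k :=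
    Polynomial.eval₂_eq_sum_range' _ ha _
  simp_rw [rotation_pow] at h
  rw [h]
  simp [Matrix.sum_apply, Matrix.mul_apply, Fin.sum_univ_two, Matrix.scalar_apply,
    ← Quaternion.coe_mul_eq_smul, Quaternion.coe_commutes]

theorem circle_pow (I : imagUnits) (θ : ℝ) (k : ℕ) :
    (sliceHom I ⟨Real.cos θ, Real.sin θ⟩) ^ k =
      (Real.cos (k * θ) : ℍ) + I * (Real.sin (k * θ) : ℍ) := by
  rw [← map_pow]
  have h : ∀ θ : ℝ, (⟨Real.cos θ, Real.sin θ⟩ : ℂ) =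
      Complex.cos θ + Complex.sin θ * Complex.I := fun θ => by
    apply Complex.ext <;> simp [Complex.cos_ofReal_re, Complex.sin_ofReal_re]
  have e : (k : ℂ) * (θ : ℂ) = ((k * θ : ℝ) : ℂ) := by push_cast; rfl
  rw [h, Complex.cos_add_sin_mul_I_pow, e, ← h, sliceHom_mk]

/-- A quaternionic polynomial bounded on the unit sphere is an `ℓ²` multiplier. -/
theorem sum_norm_sq_coeff_mul_le {F g : Polynomial ℍ} {M : ℕ} {c : ℝ} (hF : F.natDegree < M)
    (hg : g.natDegree < M) (hFg : (F * g).natDegree < M)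
    (h : ∀ q : ℍ, ‖q‖ = 1 → ‖∑ k ∈ Finset.range M, q ^ k * F.coeff k‖ ≤ c) :
    ∑ k ∈ Finset.range M, ‖(F * g).coeff k‖ ^ 2 ≤
      c ^ 2 * ∑ k ∈ Finset.range M, ‖g.coeff k‖ ^ 2 := by
  have h2pi : 0 < 2 * Real.pi := by positivity
  refine le_of_mul_le_mul_left ?_ h2pi
  -- By Parseval both sides are integrals over the circle in ℍ ⊗ ℂ. There evaluation at e^{iθ} is a
  -- ring homomorphism, which evaluation at a unit quaternion is not.
  rw [mul_left_comm, ← integral_norm_sq_trig, ← integral_norm_sq_trig,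
    ← intervalIntegral.integral_const_mul]
  refine intervalIntegral.integral_mono_on h2pi.le (Continuous.intervalIntegrable (by fun_prop) _ _)
    (Continuous.intervalIntegrable (by fun_prop) _ _) fun θ _ => ?_
  obtain ⟨F1, F2, F3, F4⟩ := circleEval_apply θ hF
  obtain ⟨g1, g2, -, -⟩ := circleEval_apply θ hg
  obtain ⟨m1, m2, -, -⟩ := circleEval_apply θ hFg
  rw [map_mul, Matrix.mul_apply, Fin.sum_univ_two, g1, g2] at m1 m2
  rw [F1, F3] at m1
  rw [F2, F4] at m2
  rw [← m1, ← m2, neg_mul, ← sub_eq_add_neg, add_comm (_ * _) (_ * _)]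
  -- Here α and β are the cosine and sine sums of F, and α + Iβ is the value of F at the unit
  -- quaternion cos θ + I sin θ, where the hypothesis applies.
  refine norm_sq_complexified_mul_le (fun I hI => ?_) _ _
  have hn : ‖sliceHom ⟨I, hI⟩ ⟨Real.cos θ, Real.sin θ⟩‖ = 1 := by
    rw [norm_sliceHom]
    have := Complex.normSq_eq_norm_sq ⟨Real.cos θ, Real.sin θ⟩
    rw [Complex.normSq_mk] at this
    nlinarith [Real.sin_sq_add_cos_sq θ, norm_nonneg (⟨Real.cos θ, Real.sin θ⟩ : ℂ)]
  convert h _ hn using 2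
  rw [Finset.mul_sum, ← Finset.sum_add_distrib]
  refine Finset.sum_congr rfl fun k _ => ?_
  rw [circle_pow, add_mul, ← Quaternion.coe_mul_eq_smul, ← Quaternion.coe_mul_eq_smul, mul_assoc]

open PowerSeries in
/-- The scaled partial sums of the Taylor series of a bounded slice regular function. -/
theorem SliceSchur.norm_partial_sum_le {f : ℍ → ℍ} (hf : SliceSchur f) {r : ℝ} (h0 : 0 ≤ r)
    (h1 : r < 1) (M : ℕ) {q : ℍ} (hq : ‖q‖ = 1) :
    ‖∑ k ∈ Finset.range M, q ^ k * ((r ^ k : ℝ) • coeff k (sliceTaylor f))‖ ≤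
      1 + ∑' k, ‖coeff (k + M) (sliceTaylor f)‖ * r ^ (k + M) := by
  have hrq : (r : ℍ) * q ∈ quatBall := by
    simp [quatBall, norm_mul, Quaternion.norm_coe, hq, abs_of_nonneg h0, h1]
  have hterm : ∀ k, ((r : ℍ) * q) ^ k * coeff k (sliceTaylor f) =
      q ^ k * ((r ^ k : ℝ) • coeff k (sliceTaylor f)) := fun k => by
    rw [(Quaternion.coe_commute r q).mul_pow, ← Quaternion.coe_pow, Quaternion.coe_commutes,
      ← Quaternion.coe_mul_eq_smul, mul_assoc]
  have hs := hf.1.convergesOnBall.summable hrq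
  have hval := hf.1.eq_sliceEval hrq
  have hb := hf.2 _ hrq
  rw [hval, sliceEval, ← hs.sum_add_tsum_nat_add M] at hb
  simp_rw [hterm] at hb
  have hnorm : ∀ k, ‖q ^ k * ((r ^ k : ℝ) • coeff k (sliceTaylor f))‖ =
      ‖coeff k (sliceTaylor f)‖ * r ^ k := fun k => by
    rw [norm_mul, norm_pow, hq, one_pow, one_mul, norm_smul, Real.norm_of_nonneg (by positivity),
      mul_comm]
  have hsum := (summable_nat_add_iff M).2 (hf.1.convergesOnBall r h0 h1)
  have htail : ‖∑' k, q ^ (k + M) * ((r ^ (k + M) : ℝ) • coeff (k + M) (sliceTaylor f))‖ ≤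
      ∑' k, ‖coeff (k + M) (sliceTaylor f)‖ * r ^ (k + M) := by
    refine tsum_of_norm_bounded hsum.hasSum fun k => (hnorm _).le
  have := norm_le_add_norm_add (∑ k ∈ Finset.range M, q ^ k * ((r ^ k : ℝ) • coeff k (sliceTaylor f)))
    (∑' k, q ^ (k + M) * ((r ^ (k + M) : ℝ) • coeff (k + M) (sliceTaylor f)))
  linarith

open PowerSeries in
/-- Multiplication by a slice regular function with values in the closed unit ball is a
contraction on `ℓ²`. -/
theorem SliceSchur.contractive {f : ℍ → ℍ} (hf : SliceSchur f) :
    Contractive (sliceTaylor f) := by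
  intro N g
  set a := sliceTaylor f with ha
  refine (sq_le_sq₀ (truncNorm_nonneg _ _) (truncNorm_nonneg _ _)).1 ?_
  rw [truncNorm_sq, truncNorm_sq]
  set D := ∑ k ∈ Finset.range (N + 1), ‖coeff k g‖ ^ 2 with hD
  -- The dilation f(rq), cut off at degree M, is a polynomial bounded on the unit sphere by 1 plus a
  -- tail. For M > N the cutoff does not affect the coefficients 0, …, N of the product. Letting M →
  -- ∞ and then r → 1 removes both modifications.
  have hM : ∀ r : ℝ, 0 ≤ r → r < 1 → ∀ M : ℕ, N + 1 ≤ M →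
      ∑ k ∈ Finset.range (N + 1), ‖∑ p ∈ Finset.HasAntidiagonal.antidiagonal k,
        ((r ^ p.1 : ℝ) • coeff p.1 a) * coeff p.2 g‖ ^ 2 ≤
      (1 + ∑' k, ‖coeff (k + M) a‖ * r ^ (k + M)) ^ 2 * D := by
    intro r h0 h1 M hNM
    let F : Polynomial ℍ := trunc M (PowerSeries.mk fun k => (r ^ k : ℝ) • coeff k a)
    let G : Polynomial ℍ := trunc (N + 1) g
    have hM0 : M ≠ 0 := by omega
    have hFd : F.natDegree < M := by
      obtain ⟨m, rfl⟩ := Nat.exists_eq_succ_of_ne_zero hM0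
      exact natDegree_trunc_lt _ _
    have hGd : G.natDegree < N + 1 := natDegree_trunc_lt _ _
    have hFGd : (F * G).natDegree < 2 * M :=
      (Polynomial.natDegree_mul_le).trans_lt (by omega)
    have hFc : ∀ k, F.coeff k = if k < M then (r ^ k : ℝ) • coeff k a else 0 := fun k => by
      simp [F, coeff_trunc]
    have hGc : ∀ k, G.coeff k = if k < N + 1 then coeff k g else 0 := fun k => by
      simp [G, coeff_trunc]
    have key := sum_norm_sq_coeff_mul_le (F := F) (g := G) (M := 2 * M)
      (c := 1 + ∑' k, ‖coeff (k + M) a‖ * r ^ (k + M)) (by omega) (by omega) hFGd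
      (fun q hq => by
        rw [← Finset.sum_subset (Finset.range_mono (by omega : M ≤ 2 * M))]
        · rw [Finset.sum_congr rfl fun k hk => by rw [hFc, if_pos (Finset.mem_range.1 hk)]]
          exact hf.norm_partial_sum_le h0 h1 M hq
        · intro k _ hk
          rw [hFc, if_neg (by simpa using hk), mul_zero])
    have hR : ∑ k ∈ Finset.range (2 * M), ‖G.coeff k‖ ^ 2 = D := by
      rw [← Finset.sum_subset (Finset.range_mono (by omega : N + 1 ≤ 2 * M))]
      · exact Finset.sum_congr rfl fun k hk => by rw [hGc, if_pos (Finset.mem_range.1 hk)]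
      · intro k _ hk
        rw [hGc, if_neg (by simpa using hk)]
        simp
    rw [hR] at key
    refine le_trans ?_ key
    refine le_trans (le_of_eq ?_) (Finset.sum_le_sum_of_subset_of_nonneg
      (Finset.range_mono (by omega : N + 1 ≤ 2 * M)) fun _ _ _ => by positivity)
    refine Finset.sum_congr rfl fun k hk => ?_
    rw [Polynomial.coeff_mul]
    congr 2
    refine Finset.sum_congr rfl fun p hp => ?_
    have h2 := Finset.HasAntidiagonal.mem_antidiagonal.1 hp
    have h3 := Finset.mem_range.1 hk
    rw [hFc, hGc, if_pos (by omega), if_pos (by omega)]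
  have hr : ∀ r : ℝ, 0 ≤ r → r < 1 →
      ∑ k ∈ Finset.range (N + 1), ‖∑ p ∈ Finset.HasAntidiagonal.antidiagonal k,
        ((r ^ p.1 : ℝ) • coeff p.1 a) * coeff p.2 g‖ ^ 2 ≤ D := by
    intro r h0 h1
    have hlim := tendsto_sum_nat_add fun k => ‖coeff k a‖ * r ^ k
    have hlim2 := ((hlim.const_add 1).pow 2).mul_const D
    rw [add_zero, one_pow, one_mul] at hlim2
    refine ge_of_tendsto hlim2 ?_
    filter_upwards [Filter.eventually_ge_atTop (N + 1)] with M hNM using hM r h0 h1 M hNM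
  have hcont : Continuous fun r : ℝ =>
      ∑ k ∈ Finset.range (N + 1), ‖∑ p ∈ Finset.HasAntidiagonal.antidiagonal k,
        ((r ^ p.1 : ℝ) • coeff p.1 a) * coeff p.2 g‖ ^ 2 := by
    fun_prop
  have hle := le_of_tendsto (hcont.continuousWithinAt (s := Set.Iio 1) (x := 1)).tendsto (b := D) (by
    filter_upwards [Ioo_mem_nhdsLT (zero_lt_one (α := ℝ))] with r hr' using hr r hr'.1.le hr'.2)
  simpa [PowerSeries.coeff_mul] using hle

/-! ### The Pick matrix: Stein identity, quadratic form and invertibility -/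

section Pick

variable {n : ℕ} {p s : Fin n → ℍ}

theorem norm_lt_one_of_mem_quatBall {q : ℍ} (hq : q ∈ quatBall) : ‖q‖ < 1 := by
  simpa [quatBall] using hq

theorem one_sub_ne_zero_of_norm_lt {q : ℍ} (hq : ‖q‖ < 1) : 1 - q ≠ 0 := fun h => by
  rw [← sub_eq_zero.1 h, norm_one] at hq
  exact lt_irrefl _ hq

/-- The Stein identity `P - T P T* = E E* - N N*`. -/
theorem pickMatrix_stein (hp : ∀ i, p i ∈ quatBall) (i j : Fin n) :
    pickMatrix p s i j - p i * pickMatrix p s i j * star (p j) = 1 - s i * star (s j) := by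
  have hi := norm_lt_one_of_mem_quatBall (hp i)
  have hj := norm_lt_one_of_mem_quatBall (hp j)
  have hs : Summable fun k : ℕ => p i ^ k * (1 - s i * star (s j)) * star (p j) ^ k := by
    refine Summable.of_norm ?_
    refine Summable.of_nonneg_of_le (fun _ => norm_nonneg _) (fun k => ?_)
      ((summable_geometric_of_lt_one (norm_nonneg _) hi).mul_right ‖1 - s i * star (s j)‖)
    rw [norm_mul, norm_mul, norm_pow, norm_pow, Quaternion.norm_star]
    exact mul_le_of_le_one_right (by positivity) (pow_le_one₀ (norm_nonneg _) hj.le)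
  simp only [pickMatrix, Matrix.of_apply]
  have h : ∀ k : ℕ, p i ^ (k + 1) * (1 - s i * star (s j)) * star (p j) ^ (k + 1) =
      p i * (p i ^ k * (1 - s i * star (s j)) * star (p j) ^ k) * star (p j) := fun k => by
    rw [pow_succ', pow_succ]
    simp only [mul_assoc]
  have e := hs.tsum_eq_zero_add
  rw [funext h, tsum_mul_right, tsum_mul_left] at e
  rw [sub_eq_iff_eq_add]
  simpa using e

/-- The real bilinear form `Re (a* P b)` of the Pick matrix. -/
noncomputable def pickForm (p s : Fin n → ℍ) (a b : Fin n → ℍ) : ℝ :=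
  (∑ i, star (a i) * ∑ j, pickMatrix p s i j * b j).re

theorem pickForm_pos (hP : QuatPosDef (pickMatrix p s)) {x : Fin n → ℍ} (hx : x ≠ 0) :
    0 < pickForm p s x x := hP.2 x hx

theorem pickForm_nonneg (hP : QuatPosDef (pickMatrix p s)) (x : Fin n → ℍ) :
    0 ≤ pickForm p s x x := by
  by_cases hx : x = 0
  · simp [hx, pickForm]
  · exact (pickForm_pos hP hx).le

theorem pickForm_comm (hP : QuatPosDef (pickMatrix p s)) (a b : Fin n → ℍ) :
    pickForm p s a b = pickForm p s b a := by
  rw [pickForm, pickForm, ← Quaternion.re_star]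
  congr 1
  simp only [Finset.mul_sum, star_sum, star_mul, star_star, mul_assoc]
  rw [Finset.sum_comm]
  refine Finset.sum_congr rfl fun j _ => Finset.sum_congr rfl fun i _ => ?_
  rw [hP.1.apply]

theorem pickForm_add_left (a b c : Fin n → ℍ) :
    pickForm p s (a + b) c = pickForm p s a c + pickForm p s b c := by
  simp [pickForm, add_mul, Finset.sum_add_distrib]

theorem pickForm_add_right (a b c : Fin n → ℍ) :
    pickForm p s a (b + c) = pickForm p s a b + pickForm p s a c := by
  simp [pickForm, mul_add, Finset.sum_add_distrib]

theorem pickForm_add_self (hP : QuatPosDef (pickMatrix p s)) (a b : Fin n → ℍ) :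
    pickForm p s (a + b) (a + b) = pickForm p s a a + 2 * pickForm p s a b + pickForm p s b b := by
  rw [pickForm_add_left, pickForm_add_right, pickForm_add_right, pickForm_comm hP b a]
  ring

/-- The Stein identity for the form. -/
theorem pickForm_stein (hp : ∀ i, p i ∈ quatBall) (η : Fin n → ℍ) :
    pickForm p s η η - pickForm p s (fun i => star (p i) * η i) (fun i => star (p i) * η i) =
      ‖∑ i, η i‖ ^ 2 - ‖∑ i, star (s i) * η i‖ ^ 2 := by
  have h1 : ∀ z : ℍ, ‖z‖ ^ 2 = (star z * z).re := fun z => by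
    rw [Quaternion.star_mul_self, Quaternion.normSq_eq_norm_mul_self, sq, Quaternion.re_coe]
  rw [h1, h1, pickForm, pickForm, ← Quaternion.re_sub, ← Quaternion.re_sub]
  congr 1
  rw [star_sum, star_sum, Finset.sum_mul_sum, Finset.sum_mul_sum]
  simp only [star_mul, star_star, Finset.mul_sum]
  simp only [← Finset.sum_sub_distrib]
  refine Finset.sum_congr rfl fun i _ => Finset.sum_congr rfl fun j _ => ?_
  have h := pickMatrix_stein (s := s) hp i j
  calc _ = star (η i) * (pickMatrix p s i j - p i * pickMatrix p s i j * star (p j)) * η j := by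
        noncomm_ring
    _ = _ := by rw [h]; noncomm_ring

/-- The energy balance of one step of the system. -/
theorem energy_step (hp : ∀ i, p i ∈ quatBall) (hP : QuatPosDef (pickMatrix p s))
    {η v : Fin n → ℍ} {u₁ u₂ : ℍ}
    (hv : ∀ i, (1 - p i) * ∑ j, pickMatrix p s i j * v j = u₁ - s i * u₂) :
    pickForm p s (fun i => star (p i) * η i + v i) (fun i => star (p i) * η i + v i) -
        pickForm p s (fun i => η i + v i) (fun i => η i + v i) =
      ‖u₁‖ ^ 2 - ‖u₂‖ ^ 2 - ‖u₁ + ∑ i, η i‖ ^ 2 + ‖u₂ + ∑ i, star (s i) * η i‖ ^ 2 := by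
  have h1 := pickForm_add_self hP (fun i => star (p i) * η i) v
  have h2 := pickForm_add_self hP η v
  have h3 := pickForm_stein (s := s) hp η
  have h4 : ∀ a b : ℍ, ‖a + b‖ ^ 2 = ‖a‖ ^ 2 + ‖b‖ ^ 2 + 2 * (star b * a).re := fun a b => by
    simp only [sq, ← Quaternion.normSq_eq_norm_mul_self, Quaternion.normSq_def']
    simp
    ring
  -- The input equation (I − T)Pv = E u₁ − N u₂ turns the difference of the mixed terms into the
  -- mixed terms of |u₁ + E*η|² and |u₂ + N*η|². This is what the factor (I − T)⁻¹ in Θ is for.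
  have h5 : pickForm p s η v - pickForm p s (fun i => star (p i) * η i) v =
      (star (∑ i, η i) * u₁).re - (star (∑ i, star (s i) * η i) * u₂).re := by
    rw [pickForm, pickForm, ← Quaternion.re_sub, ← Quaternion.re_sub]
    congr 1
    simp only [star_sum, star_mul, star_star, Finset.sum_mul]
    simp only [← Finset.sum_sub_distrib]
    refine Finset.sum_congr rfl fun i _ => ?_
    have := hv i
    calc _ = star (η i) * ((1 - p i) * ∑ j, pickMatrix p s i j * v j) := by noncomm_ring
      _ = _ := by rw [this]; noncomm_ring
  rw [h4 u₁, h4 u₂]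
  change pickForm p s ((fun i => star (p i) * η i) + v) ((fun i => star (p i) * η i) + v) -
    pickForm p s (η + v) (η + v) = _
  linarith

theorem pickMatrix_mulVec_injective (hP : QuatPosDef (pickMatrix p s)) {x : Fin n → ℍ}
    (hx : pickMatrix p s *ᵥ x = 0) : x = 0 := by
  by_contra h
  have := hP.2 x h
  rw [hx] at this
  simp at this

theorem isUnit_pickMatrix (hP : QuatPosDef (pickMatrix p s)) : IsUnit (pickMatrix p s) := by
  set P := pickMatrix p s with hPdef
  -- As a real linear endomorphism of a finite-dimensional space, P is surjective once it is
  -- injective. Preimages of the unit vectors are the columns of a right inverse.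
  let T : (Fin n → ℍ) →ₗ[ℝ] (Fin n → ℍ) :=
    { toFun := fun x => P *ᵥ x
      map_add' := Matrix.mulVec_add P
      map_smul' := fun r x => Matrix.mulVec_smul P r x }
  have hinj : Function.Injective T := by
    rw [← LinearMap.ker_eq_bot, LinearMap.ker_eq_bot']
    exact fun x hx => pickMatrix_mulVec_injective hP hx
  have hsurj : Function.Surjective T := LinearMap.injective_iff_surjective.1 hinj
  choose R hR using fun j : Fin n => hsurj (Pi.single j 1)
  let Q : Matrix (Fin n) (Fin n) ℍ := Matrix.of fun i j => R j i
  have hPQ : P * Q = 1 := by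
    refine Matrix.ext fun i j => ?_
    have := congrFun (hR j) i
    rw [Matrix.one_apply]
    simpa [T, Matrix.mulVec, dotProduct, Matrix.mul_apply, Q, Pi.single_apply] using this
  have hQP : Q * P = 1 := by
    refine Matrix.ext fun i j => ?_
    -- Injectivity of P, applied column by column, makes the right inverse two-sided.
    have h0 : P * (Q * P - 1) = 0 := by rw [mul_sub, ← mul_assoc, hPQ]; simp
    have h1 : P *ᵥ (fun i => (Q * P - 1) i j) = 0 := by
      ext1 k
      exact congrFun (congrFun h0 k) j
    have h2 := congrFun (pickMatrix_mulVec_injective hP h1) i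
    exact sub_eq_zero.1 h2
  exact ⟨⟨P, Q, hPQ, hQP⟩, rfl⟩

theorem pickMatrix_mul_inverse (hP : QuatPosDef (pickMatrix p s)) :
    pickMatrix p s * Ring.inverse (pickMatrix p s) = 1 :=
  Ring.mul_inverse_cancel _ (isUnit_pickMatrix hP)

theorem inverse_mul_pickMatrix (hP : QuatPosDef (pickMatrix p s)) :
    Ring.inverse (pickMatrix p s) * pickMatrix p s = 1 :=
  Ring.inverse_mul_cancel _ (isUnit_pickMatrix hP)

theorem inverse_one_sub_diagonal (hp : ∀ i, p i ∈ quatBall) :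
    Ring.inverse (1 - Matrix.diagonal p) = Matrix.diagonal fun i => (1 - p i)⁻¹ := by
  have h : ∀ i, 1 - p i ≠ 0 := fun i =>
    one_sub_ne_zero_of_norm_lt (norm_lt_one_of_mem_quatBall (hp i))
  have e : (1 - Matrix.diagonal p : Matrix (Fin n) (Fin n) ℍ) =
      Matrix.diagonal fun i => 1 - p i := by
    rw [← Matrix.diagonal_one, Matrix.diagonal_sub]
  have h1 : (1 - Matrix.diagonal p) * Matrix.diagonal (fun i => (1 - p i)⁻¹) = 1 := by
    rw [e, Matrix.diagonal_mul_diagonal, ← Matrix.diagonal_one]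
    congr 1
    ext1 i
    exact mul_inv_cancel₀ (h i)
  have h2 : Matrix.diagonal (fun i => (1 - p i)⁻¹) * (1 - Matrix.diagonal p) = 1 := by
    rw [e, Matrix.diagonal_mul_diagonal, ← Matrix.diagonal_one]
    congr 1
    ext1 i
    exact inv_mul_cancel₀ (h i)
  exact Ring.inverse_unit ⟨_, _, h1, h2⟩

theorem sum_C_mul_sum_C_mul {A B : Matrix (Fin n) (Fin n) ℍ} (h : A * B = 1)
    (w : Fin n → PowerSeries ℍ) (i : Fin n) :
    ∑ j, PowerSeries.C (A i j) * ∑ k, PowerSeries.C (B j k) * w k = w i := by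
  simp_rw [Finset.mul_sum, ← mul_assoc, ← map_mul]
  rw [Finset.sum_comm]
  simp_rw [← Finset.sum_mul, ← map_sum, ← Matrix.mul_apply, h, Matrix.one_apply]
  simp

end Pick

open PowerSeries

/-! ### Θ as the transfer function of a state space system -/

section Theta

variable {n : ℕ} {p s : Fin n → ℍ}

/-- The coefficients of the series in the definition of `Θ`. -/
noncomputable def thetaCoeff (p s : Fin n → ℍ) (k : ℕ) : Matrix (Fin 2) (Fin 2) ℍ :=
  rowsEN s * (Matrix.diagonal p)ᴴ ^ k * Ring.inverse (pickMatrix p s) *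
    Ring.inverse (1 - Matrix.diagonal p) * colsEN s

/-- The entries of `Θ` as power series. -/
noncomputable def thetaSeries (p s : Fin n → ℍ) (a b : Fin 2) : PowerSeries ℍ :=
  C ((1 : Matrix (Fin 2) (Fin 2) ℍ) a b) + (X - 1) * mk fun k => thetaCoeff p s k a b

/-- The input weights `P⁻¹ (I - T)⁻¹ [E  -N]`. -/
noncomputable def thetaInput (p s : Fin n → ℍ) : Matrix (Fin n) (Fin 2) ℍ :=
  Ring.inverse (pickMatrix p s) * (Ring.inverse (1 - Matrix.diagonal p) * colsEN s)

/-- The geometric series `∑ z ^ k c ^ k`. -/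
noncomputable def geomSeries (c : ℍ) : PowerSeries ℍ := mk fun k => c ^ k

theorem X_mul_left_comm (c a : PowerSeries ℍ) : X * (c * a) = c * (X * a) := by
  rw [← mul_assoc, ← (PowerSeries.commute_X c).eq, mul_assoc]

theorem geomSeries_eq (c : ℍ) : geomSeries c = 1 + C c * (X * geomSeries c) := by
  ext1 k
  cases k with
  | zero => simp [geomSeries]
  | succ k =>
    simp [geomSeries, PowerSeries.coeff_succ_X_mul, PowerSeries.coeff_one, pow_succ']

theorem geomSeries_mul (c : ℍ) : geomSeries c * (1 - C c * X) = 1 := by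
  have h : C c * (X * geomSeries c) = geomSeries c * (C c * X) := by
    rw [← (PowerSeries.commute_X (geomSeries c)).eq, ← mul_assoc, ← mul_assoc]
    congr 1
    ext1 k
    simp [geomSeries, ← pow_succ, ← pow_succ']
  rw [mul_sub, mul_one, ← h, sub_eq_iff_eq_add]
  exact geomSeries_eq c

theorem thetaCoeff_apply (k : ℕ) (a b : Fin 2) :
    thetaCoeff p s k a b = ∑ i, rowsEN s a i * star (p i) ^ k * thetaInput p s i b := by
  rw [thetaCoeff, Matrix.mul_assoc, Matrix.mul_assoc, Matrix.diagonal_conjTranspose,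
    Matrix.diagonal_pow, Matrix.mul_apply]
  simp [thetaInput, Matrix.mul_diagonal]

theorem mk_thetaCoeff (a b : Fin 2) : (mk fun k => thetaCoeff p s k a b) =
    ∑ i, C (rowsEN s a i) * (geomSeries (star (p i)) * C (thetaInput p s i b)) := by
  ext1 k
  simp [thetaCoeff_apply, geomSeries, mul_assoc]

theorem thetaInput_zero (hp : ∀ i, p i ∈ quatBall) (i : Fin n) :
    thetaInput p s i 0 = ∑ j, Ring.inverse (pickMatrix p s) i j * (1 - p j)⁻¹ := by
  rw [thetaInput, inverse_one_sub_diagonal hp, Matrix.mul_apply]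
  simp [Matrix.diagonal_mul, colsEN]

theorem thetaInput_one (hp : ∀ i, p i ∈ quatBall) (i : Fin n) :
    thetaInput p s i 1 = -∑ j, Ring.inverse (pickMatrix p s) i j * (1 - p j)⁻¹ * s j := by
  rw [thetaInput, inverse_one_sub_diagonal hp, Matrix.mul_apply]
  simp [Matrix.diagonal_mul, colsEN, mul_assoc]

theorem convergesOnBall_mk_thetaCoeff (hp : ∀ i, p i ∈ quatBall) (a b : Fin 2) :
    ConvergesOnBall (mk fun k => thetaCoeff p s k a b) := by
  rw [mk_thetaCoeff]
  refine ConvergesOnBall.sum fun i _ => (convergesOnBall_C _).mul (.mul ?_ (convergesOnBall_C _))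
  refine .of_bounded (K := 1) fun k => ?_
  rw [geomSeries, coeff_mk, norm_pow, Quaternion.norm_star]
  exact pow_le_one₀ (norm_nonneg _) (norm_lt_one_of_mem_quatBall (hp i)).le

theorem convergesOnBall_thetaSeries (hp : ∀ i, p i ∈ quatBall) (a b : Fin 2) :
    ConvergesOnBall (thetaSeries p s a b) :=
  (convergesOnBall_C _).add
    ((convergesOnBall_X.sub convergesOnBall_one).mul (convergesOnBall_mk_thetaCoeff hp a b))

theorem thetaEntry_eq_sliceEval (hp : ∀ i, p i ∈ quatBall) (a b : Fin 2) {q : ℍ}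
    (hq : q ∈ quatBall) : thetaEntry p s a b q = sliceEval (thetaSeries p s a b) q := by
  have hc := convergesOnBall_mk_thetaCoeff (s := s) hp
  have hsum : ∀ a b, HasSum (fun k => q ^ k * thetaCoeff p s k a b)
      (sliceEval (mk fun k => thetaCoeff p s k a b) q) := fun a b => by
    simpa using (hc a b).hasSum hq
  have hmat : HasSum (fun k => q ^ k • thetaCoeff p s k)
      (Matrix.of fun a b => sliceEval (mk fun k => thetaCoeff p s k a b) q) := by
    exact (Pi.hasSum (f := fun k => (q ^ k • thetaCoeff p s k : Fin 2 → Fin 2 → ℍ))).2 fun a =>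
      Pi.hasSum.2 fun b => hsum a b
  rw [thetaSeries, sliceEval_add (convergesOnBall_C _)
    ((convergesOnBall_X.sub convergesOnBall_one).mul (hc a b)) hq, sliceEval_C,
    sliceEval_X_sub_one_mul (hc a b) hq, thetaEntry, thetaMatrix]
  change ((1 : Matrix (Fin 2) (Fin 2) ℍ) + (q - 1) • ∑' k : ℕ, q ^ k • thetaCoeff p s k) a b = _
  rw [hmat.tsum_eq]
  simp

/-- The trajectories of the state space system with transfer function `Θ`: the inputs are
`u₁, u₂`, the outputs are `y₁, y₂`, the state after the `k`-th step is the `k`-th coefficient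
of `x`, and the initial state is zero. -/
structure Trajectory (p s : Fin n → ℍ) (u₁ u₂ y₁ y₂ : PowerSeries ℍ)
    (x η v : Fin n → PowerSeries ℍ) : Prop where
  next : ∀ i, x i = C (star (p i)) * η i + v i
  prev : ∀ i, X * x i = η i + v i
  out₁ : y₁ = u₁ + ∑ i, η i
  out₂ : y₂ = u₂ + ∑ i, C (star (s i)) * η i
  input : ∀ i, C (1 - p i) * ∑ j, C (pickMatrix p s i j) * v j = u₁ - C (s i) * u₂

theorem Trajectory.mul_right {u₁ u₂ y₁ y₂ : PowerSeries ℍ} {x η v : Fin n → PowerSeries ℍ}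
    (h : Trajectory p s u₁ u₂ y₁ y₂ x η v) (g : PowerSeries ℍ) :
    Trajectory p s (u₁ * g) (u₂ * g) (y₁ * g) (y₂ * g)
      (fun i => x i * g) (fun i => η i * g) (fun i => v i * g) where
  next i := by rw [h.next, add_mul, mul_assoc]
  prev i := by rw [← mul_assoc, h.prev, add_mul]
  out₁ := by rw [h.out₁, add_mul, Finset.sum_mul]
  out₂ := by simp_rw [h.out₂, add_mul, Finset.sum_mul, mul_assoc]
  input i := by
    rw [← mul_assoc (C (s i)), ← sub_mul, ← h.input, mul_assoc, Finset.sum_mul]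
    simp_rw [mul_assoc]

theorem Trajectory.energy_coeff (hp : ∀ i, p i ∈ quatBall) (hP : QuatPosDef (pickMatrix p s))
    {u₁ u₂ y₁ y₂ : PowerSeries ℍ} {x η v : Fin n → PowerSeries ℍ}
    (h : Trajectory p s u₁ u₂ y₁ y₂ x η v) (k : ℕ) :
    pickForm p s (fun i => coeff k (x i)) (fun i => coeff k (x i)) -
        pickForm p s (fun i => coeff k (X * x i)) (fun i => coeff k (X * x i)) =
      ‖coeff k u₁‖ ^ 2 - ‖coeff k u₂‖ ^ 2 - ‖coeff k y₁‖ ^ 2 + ‖coeff k y₂‖ ^ 2 := by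
  have hv : ∀ i, (1 - p i) * ∑ j, pickMatrix p s i j * coeff k (v j) =
      coeff k u₁ - s i * coeff k u₂ := fun i => by
    have := congrArg (coeff k) (h.input i)
    rw [coeff_C_mul, map_sum, map_sub] at this
    simpa only [coeff_C_mul] using this
  have := energy_step hp hP (η := fun i => coeff k (η i)) hv
  rw [h.out₁, h.out₂]
  simp_rw [h.prev, h.next, map_add, map_sum, coeff_C_mul]
  exact this

/-- The energy balance of a trajectory. -/
theorem Trajectory.energy (hp : ∀ i, p i ∈ quatBall) (hP : QuatPosDef (pickMatrix p s))
    {u₁ u₂ y₁ y₂ : PowerSeries ℍ} {x η v : Fin n → PowerSeries ℍ}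
    (h : Trajectory p s u₁ u₂ y₁ y₂ x η v) (N : ℕ) :
    pickForm p s (fun i => coeff N (x i)) (fun i => coeff N (x i)) =
      truncNorm N u₁ ^ 2 - truncNorm N u₂ ^ 2 - truncNorm N y₁ ^ 2 + truncNorm N y₂ ^ 2 := by
  simp_rw [truncNorm_sq]
  induction N with
  | zero =>
    have := h.energy_coeff hp hP 0
    simp only [coeff_zero_X_mul] at this
    simp only [zero_add, Finset.sum_range_one]
    rw [← this]
    simp [pickForm]
  | succ N ih =>
    have := h.energy_coeff hp hP (N + 1)
    simp only [coeff_succ_X_mul] at this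
    simp only [Finset.sum_range_succ _ (N + 1)]
    linarith

/-- The states, multiplied by the Pick matrix, are divided differences of the outputs. -/
theorem Trajectory.interpolation (hp : ∀ i, p i ∈ quatBall)
    {u₁ u₂ y₁ y₂ : PowerSeries ℍ} {x η v : Fin n → PowerSeries ℍ}
    (h : Trajectory p s u₁ u₂ y₁ y₂ x η v) (i : Fin n) :
    (X - C (p i)) * ∑ j, C (pickMatrix p s i j) * x j = y₁ - C (s i) * y₂ := by
  have e1 : X * ∑ j, C (pickMatrix p s i j) * x j =
      ∑ j, C (pickMatrix p s i j) * η j + ∑ j, C (pickMatrix p s i j) * v j := by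
    rw [Finset.mul_sum, ← Finset.sum_add_distrib]
    refine Finset.sum_congr rfl fun j _ => ?_
    rw [X_mul_left_comm, h.prev, mul_add]
  have e2 : C (p i) * ∑ j, C (pickMatrix p s i j) * x j =
      ∑ j, C (p i * pickMatrix p s i j * star (p j)) * η j +
        C (p i) * ∑ j, C (pickMatrix p s i j) * v j := by
    rw [Finset.mul_sum, Finset.mul_sum, ← Finset.sum_add_distrib]
    refine Finset.sum_congr rfl fun j _ => ?_
    rw [h.next, map_mul, map_mul]
    noncomm_ring
  have e3 : ∑ j, C (pickMatrix p s i j) * η j -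
      ∑ j, C (p i * pickMatrix p s i j * star (p j)) * η j =
      ∑ j, η j - C (s i) * ∑ j, C (star (s j)) * η j := by
    rw [Finset.mul_sum, ← Finset.sum_sub_distrib, ← Finset.sum_sub_distrib]
    refine Finset.sum_congr rfl fun j _ => ?_
    rw [← sub_mul, ← map_sub, pickMatrix_stein hp, map_sub, map_mul, map_one]
    noncomm_ring
  have e4 := h.input i
  rw [map_sub, map_one, sub_mul, one_mul] at e4
  rw [sub_mul, e1, e2, h.out₁, h.out₂, mul_add]
  calc _ = (∑ j, C (pickMatrix p s i j) * η j -
      ∑ j, C (p i * pickMatrix p s i j * star (p j)) * η j) +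
      (∑ j, C (pickMatrix p s i j) * v j - C (p i) * ∑ j, C (pickMatrix p s i j) * v j) := by abel
    _ = _ := by rw [e3, e4]; abel

theorem Trajectory.input_eq (hp : ∀ i, p i ∈ quatBall) (hP : QuatPosDef (pickMatrix p s))
    {u₁ u₂ y₁ y₂ : PowerSeries ℍ} {x η v : Fin n → PowerSeries ℍ}
    (h : Trajectory p s u₁ u₂ y₁ y₂ x η v) (i : Fin n) :
    v i = C (thetaInput p s i 0) * u₁ + C (thetaInput p s i 1) * u₂ := by
  have h1 : ∀ j, ∑ k, C (pickMatrix p s j k) * v k = C (1 - p j)⁻¹ * (u₁ - C (s j) * u₂) :=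
    fun j => by
      rw [← h.input, ← mul_assoc, ← map_mul, inv_mul_cancel₀
        (one_sub_ne_zero_of_norm_lt (norm_lt_one_of_mem_quatBall (hp j))), map_one, one_mul]
  rw [← sum_C_mul_sum_C_mul (inverse_mul_pickMatrix hP) v i, thetaInput_zero hp,
    thetaInput_one hp]
  simp_rw [h1]
  simp only [map_sum, map_neg, map_mul, Finset.sum_mul, neg_mul]
  rw [← sub_eq_add_neg, ← Finset.sum_sub_distrib]
  refine Finset.sum_congr rfl fun j _ => ?_
  noncomm_ring

theorem output_aux {u₁ u₂ : PowerSeries ℍ} {η v : Fin n → PowerSeries ℍ}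
    (hv : ∀ i, v i = C (thetaInput p s i 0) * u₁ + C (thetaInput p s i 1) * u₂)
    (hη : ∀ i, η i = (X - 1) * (geomSeries (star (p i)) * v i)) (a : Fin 2) :
    thetaSeries p s a 0 * u₁ + thetaSeries p s a 1 * u₂ =
      C ((1 : Matrix (Fin 2) (Fin 2) ℍ) a 0) * u₁ + C ((1 : Matrix (Fin 2) (Fin 2) ℍ) a 1) * u₂ +
        ∑ i, C (rowsEN s a i) * η i := by
  have h : ∑ i, C (rowsEN s a i) * η i = (X - 1) * ((mk fun k => thetaCoeff p s k a 0) * u₁ +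
      (mk fun k => thetaCoeff p s k a 1) * u₂) := by
    rw [mk_thetaCoeff, mk_thetaCoeff, Finset.sum_mul, Finset.sum_mul, ← Finset.sum_add_distrib,
      Finset.mul_sum]
    refine Finset.sum_congr rfl fun i _ => ?_
    rw [hη, hv, sub_mul, mul_sub, ← X_mul_left_comm]
    noncomm_ring
  rw [h, thetaSeries, thetaSeries]
  noncomm_ring

/-- Eliminating the state from the two state equations leaves (1 − p̄_i X)η_i = (X − 1)v_i. The
geometric series inverts the left factor, which produces the factor (p − 1)∑ p^k T*^k of Θ. -/
theorem Trajectory.eta_eq {u₁ u₂ y₁ y₂ : PowerSeries ℍ} {x η v : Fin n → PowerSeries ℍ}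
    (h : Trajectory p s u₁ u₂ y₁ y₂ x η v) (i : Fin n) :
    η i = (X - 1) * (geomSeries (star (p i)) * v i) := by
  have h1 : (1 - C (star (p i)) * X) * η i = (X - 1) * v i := by
    have := h.prev i
    rw [h.next, mul_add, X_mul_left_comm] at this
    rw [sub_mul, sub_mul, one_mul, one_mul, mul_assoc, sub_eq_sub_iff_add_eq_add, add_comm (X * v i),
      this]
  have h2 : geomSeries (star (p i)) * ((1 - C (star (p i)) * X) * η i) =
      geomSeries (star (p i)) * ((X - 1) * v i) := by rw [h1]
  rw [← mul_assoc, geomSeries_mul, one_mul] at h2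
  rw [h2, sub_mul, mul_sub, sub_mul, X_mul_left_comm]
  noncomm_ring

/-- The outputs of a trajectory are obtained from the inputs by multiplication with `Θ`. -/
theorem Trajectory.output (hp : ∀ i, p i ∈ quatBall) (hP : QuatPosDef (pickMatrix p s))
    {u₁ u₂ y₁ y₂ : PowerSeries ℍ} {x η v : Fin n → PowerSeries ℍ}
    (h : Trajectory p s u₁ u₂ y₁ y₂ x η v) :
    y₁ = thetaSeries p s 0 0 * u₁ + thetaSeries p s 0 1 * u₂ ∧
      y₂ = thetaSeries p s 1 0 * u₁ + thetaSeries p s 1 1 * u₂ := by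
  rw [output_aux (h.input_eq hp hP) h.eta_eq, output_aux (h.input_eq hp hP) h.eta_eq, h.out₁,
    h.out₂]
  simp [rowsEN]

/-- Every pair of inputs gives a trajectory. -/
theorem exists_trajectory (hp : ∀ i, p i ∈ quatBall) (hP : QuatPosDef (pickMatrix p s))
    (u₁ u₂ : PowerSeries ℍ) : ∃ x η v, Trajectory p s u₁ u₂
      (thetaSeries p s 0 0 * u₁ + thetaSeries p s 0 1 * u₂)
      (thetaSeries p s 1 0 * u₁ + thetaSeries p s 1 1 * u₂) x η v := by
  set v : Fin n → PowerSeries ℍ := fun i =>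
    C (thetaInput p s i 0) * u₁ + C (thetaInput p s i 1) * u₂ with hv
  set η : Fin n → PowerSeries ℍ := fun i => (X - 1) * (geomSeries (star (p i)) * v i) with hη
  refine ⟨fun i => C (star (p i)) * η i + v i, η, v, fun _ => rfl, fun i => ?_, ?_, ?_, fun i => ?_⟩
  · have h1 : geomSeries (star (p i)) * v i =
        v i + C (star (p i)) * (X * (geomSeries (star (p i)) * v i)) := by
      conv_lhs => rw [geomSeries_eq]
      noncomm_ring
    set w := geomSeries (star (p i)) * v i
    have h2 : η i = (X - 1) * w := rfl
    have h3 : v i = w - C (star (p i)) * (X * w) := by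
      rw [eq_sub_iff_add_eq]; exact h1.symm
    rw [h2, h3]
    have h4 : ∀ t, X * (C (star (p i)) * t) = C (star (p i)) * (X * t) := fun t =>
      X_mul_left_comm _ _
    simp only [mul_add, mul_sub, sub_mul, h4, one_mul]
    abel
  · rw [output_aux (fun _ => rfl) fun _ => rfl]
    simp [rowsEN]
    rfl
  · rw [output_aux (fun _ => rfl) fun _ => rfl]
    simp [rowsEN]
    rfl
  · have h1 : ∀ j, v j = ∑ k, C (Ring.inverse (pickMatrix p s) j k) *
        (C (1 - p k)⁻¹ * (u₁ - C (s k) * u₂)) := fun j => by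
      simp only [hv, thetaInput_zero hp, thetaInput_one hp]
      simp only [map_sum, map_neg, map_mul, Finset.sum_mul, neg_mul]
      rw [← sub_eq_add_neg, ← Finset.sum_sub_distrib]
      refine Finset.sum_congr rfl fun j _ => ?_
      noncomm_ring
    simp_rw [h1]
    rw [sum_C_mul_sum_C_mul (pickMatrix_mul_inverse hP), ← mul_assoc, ← map_mul, mul_inv_cancel₀
        (one_sub_ne_zero_of_norm_lt (norm_lt_one_of_mem_quatBall (hp i))), map_one, one_mul]

end Theta

/-! ### From a Schur parameter to a solution -/

section Parametrization

variable {n : ℕ} {p s : Fin n → ℍ}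

theorem Quaternion.re_le_norm (q : ℍ) : q.re ≤ ‖q‖ := by
  have := Quaternion.norm_sq_eq_re_sq_add q
  exact (abs_le_of_sq_le_sq' (by nlinarith [sq_nonneg ‖q.im‖]) (norm_nonneg _)).2

theorem Quaternion.re_star_smul_mul_self (t : ℝ) (q : ℍ) :
    (star (t • q) * q).re = t * ‖q‖ ^ 2 := by
  simp only [sq, ← Quaternion.normSq_eq_norm_mul_self, Quaternion.normSq_def']
  simp

/-- A Cauchy-Schwarz inequality for the Pick matrix. -/
theorem norm_sq_mulVec_le_pickForm (hP : QuatPosDef (pickMatrix p s)) (i : Fin n)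
    (x : Fin n → ℍ) :
    ‖∑ j, pickMatrix p s i j * x j‖ ^ 2 ≤ (1 + ‖pickMatrix p s i i‖) * pickForm p s x x := by
  set ξ := ∑ j, pickMatrix p s i j * x j with hξ
  set K := 1 + ‖pickMatrix p s i i‖ with hK
  have hK1 : 1 ≤ K := by rw [hK]; linarith [norm_nonneg (pickMatrix p s i i)]
  -- The form is nonnegative at x + tξe_i, which is a quadratic inequality in t. The value −1/K
  -- nearly minimises it, and the 1 in K keeps K positive whatever the size of the diagonal entry.
  set t : ℝ := -K⁻¹ with ht
  let a : Fin n → ℍ := Pi.single i (t • ξ)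
  have h0 := pickForm_nonneg hP (a + x)
  rw [pickForm_add_self hP] at h0
  have h1 : pickForm p s a x = t * ‖ξ‖ ^ 2 := by
    rw [pickForm, Finset.sum_eq_single i]
    · rw [← hξ]
      simp only [a, Pi.single_eq_same]
      exact Quaternion.re_star_smul_mul_self t ξ
    · intro j _ hj; simp [a, hj]
    · simp
  have h2 : pickForm p s a a ≤ t ^ 2 * (‖pickMatrix p s i i‖ * ‖ξ‖ ^ 2) := by
    have : pickForm p s a a = (star (t • ξ) * (pickMatrix p s i i * (t • ξ))).re := by
      rw [pickForm, Finset.sum_eq_single i]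
      · congr 2
        · simp [a]
        · rw [Finset.sum_eq_single i]
          · simp [a]
          · intro j _ hj; simp [a, hj]
          · simp
      · intro j _ hj; simp [a, hj]
      · simp
    rw [this]
    refine (Quaternion.re_le_norm _).trans (le_of_eq ?_)
    rw [norm_mul, norm_mul, Quaternion.norm_star, norm_smul, Real.norm_eq_abs, ← sq_abs t]
    ring
  have hKpos : 0 < K := by linarith
  have hKK : K * K⁻¹ = 1 := mul_inv_cancel₀ hKpos.ne'
  have h3 : ‖pickMatrix p s i i‖ = K - 1 := by rw [hK]; ring
  rw [h3] at h2
  rw [h1] at h0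
  have h4 : t ^ 2 * ((K - 1) * ‖ξ‖ ^ 2) + 2 * (t * ‖ξ‖ ^ 2) =
      -(K⁻¹ * ‖ξ‖ ^ 2) - K⁻¹ ^ 2 * ‖ξ‖ ^ 2 := by
    rw [ht]
    linear_combination (K⁻¹ * ‖ξ‖ ^ 2) * hKK
  have h5 : K⁻¹ * ‖ξ‖ ^ 2 ≤ pickForm p s x x := by
    have : 0 ≤ K⁻¹ ^ 2 * ‖ξ‖ ^ 2 := by positivity
    linarith
  calc ‖ξ‖ ^ 2 = K * (K⁻¹ * ‖ξ‖ ^ 2) := by rw [← mul_assoc, hKK, one_mul]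
    _ ≤ _ := mul_le_mul_of_nonneg_left h5 hKpos.le

theorem coeff_X_sub_C_mul_succ (c : ℍ) (l : PowerSeries ℍ) (k : ℕ) :
    coeff (k + 1) ((X - C c) * l) = coeff k l - c * coeff (k + 1) l := by
  rw [sub_mul, map_sub, coeff_succ_X_mul, coeff_C_mul]

/-- A stable backward recursion is bounded by its data. -/
theorem truncNorm_sq_le_of_recursion {c : ℍ} (hc : ‖c‖ < 1) (l : PowerSeries ℍ) (N : ℕ) :
    (1 - ‖c‖) * truncNorm N l ^ 2 ≤
      ‖coeff N l‖ ^ 2 + (1 - ‖c‖)⁻¹ * truncNorm N ((X - C c) * l) ^ 2 := by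
  have h1 : 0 < 1 - ‖c‖ := by linarith
  simp_rw [truncNorm_sq]
  induction N with
  | zero =>
    have : 0 ≤ (1 - ‖c‖)⁻¹ * ‖coeff 0 ((X - C c) * l)‖ ^ 2 := by positivity
    have h2 : 0 ≤ ‖c‖ * ‖coeff 0 l‖ ^ 2 := by positivity
    simp only [zero_add, Finset.sum_range_one]
    linarith
  | succ N ih =>
    rw [Finset.sum_range_succ _ (N + 1), Finset.sum_range_succ _ (N + 1)]
    set d := coeff (N + 1) ((X - C c) * l) with hd
    have h3 : coeff N l = c * coeff (N + 1) l + d := by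
      rw [hd, coeff_X_sub_C_mul_succ]; abel
    have h4 : ‖coeff N l‖ ≤ ‖c‖ * ‖coeff (N + 1) l‖ + ‖d‖ := by
      rw [h3, ← norm_mul]; exact norm_add_le _ _
    -- Convexity: (rA + D)² ≤ rA² + D²/(1 − r). The coefficient r leaves room for the new term (1 −
    -- r)A² in the induction.
    have h5 : ‖coeff N l‖ ^ 2 ≤ ‖c‖ * ‖coeff (N + 1) l‖ ^ 2 + (1 - ‖c‖)⁻¹ * ‖d‖ ^ 2 := by
      refine (pow_le_pow_left₀ (norm_nonneg _) h4 2).trans ?_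
      set r := ‖c‖
      set A := ‖coeff (N + 1) l‖
      set D := ‖d‖
      have hi : (1 - r) * (1 - r)⁻¹ = 1 := mul_inv_cancel₀ h1.ne'
      have e : r * A ^ 2 + (1 - r)⁻¹ * D ^ 2 - (r * A + D) ^ 2 =
          r * (1 - r)⁻¹ * ((1 - r) * A - D) ^ 2 := by
        linear_combination (r * A ^ 2 * (r - 1) + 2 * r * A * D + D ^ 2) * hi
      have : 0 ≤ r * (1 - r)⁻¹ * ((1 - r) * A - D) ^ 2 := by
        have := norm_nonneg c
        positivity
      linarith
    rw [mul_add, mul_add]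
    linarith

theorem Trajectory.output_le (hp : ∀ i, p i ∈ quatBall) (hP : QuatPosDef (pickMatrix p s))
    {u₁ u₂ y₁ y₂ : PowerSeries ℍ} {x η v : Fin n → PowerSeries ℍ}
    (h : Trajectory p s u₁ u₂ y₁ y₂ x η v) {N : ℕ} (hu : truncNorm N u₁ ≤ truncNorm N u₂) :
    pickForm p s (fun i => coeff N (x i)) (fun i => coeff N (x i)) + truncNorm N y₁ ^ 2 ≤
      truncNorm N y₂ ^ 2 := by
  have h1 := h.energy hp hP N
  have h2 := pow_le_pow_left₀ (truncNorm_nonneg _ _) hu 2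
  linarith

theorem Trajectory.truncNorm_output_le (hp : ∀ i, p i ∈ quatBall)
    (hP : QuatPosDef (pickMatrix p s))
    {u₁ u₂ y₁ y₂ : PowerSeries ℍ} {x η v : Fin n → PowerSeries ℍ}
    (h : Trajectory p s u₁ u₂ y₁ y₂ x η v) {N : ℕ} (hu : truncNorm N u₁ ≤ truncNorm N u₂) :
    truncNorm N y₁ ≤ truncNorm N y₂ := by
  refine (sq_le_sq₀ (truncNorm_nonneg _ _) (truncNorm_nonneg _ _)).1 ?_
  have h1 := h.output_le hp hP hu
  have h2 := pickForm_nonneg hP fun i => coeff N (x i)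
  linarith

/-- The states are bounded by the second output if the first input is smaller than the second. -/
theorem Trajectory.exists_state_bound (hp : ∀ i, p i ∈ quatBall)
    (hP : QuatPosDef (pickMatrix p s)) (i : Fin n) :
    ∃ K : ℝ, ∀ {u₁ u₂ y₁ y₂ : PowerSeries ℍ} {x η v : Fin n → PowerSeries ℍ},
      Trajectory p s u₁ u₂ y₁ y₂ x η v → ∀ {N : ℕ}, truncNorm N u₁ ≤ truncNorm N u₂ →
      truncNorm N (∑ j, C (pickMatrix p s i j) * x j) ≤ K * truncNorm N y₂ := by
  have hc := norm_lt_one_of_mem_quatBall (hp i)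
  have h1 : 0 < 1 - ‖p i‖ := by linarith
  set K₀ := 1 + ‖pickMatrix p s i i‖ with hK₀
  -- The term K₀ accounts for the final state, controlled by the energy, and the other term for the
  -- data y₁ − s_i y₂ of the backward recursion.
  set K₁ := (1 - ‖p i‖)⁻¹ * (K₀ + (1 - ‖p i‖)⁻¹ * (1 + ‖s i‖) ^ 2) with hK₁
  have hK₁0 : 0 ≤ K₁ := by positivity
  refine ⟨Real.sqrt K₁, fun {u₁ u₂ y₁ y₂ x η v} h N hu => ?_⟩
  have hy := h.truncNorm_output_le hp hP hu
  have hE := h.output_le hp hP hu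
  set ξ := ∑ j, C (pickMatrix p s i j) * x j with hξ
  have hrec := truncNorm_sq_le_of_recursion hc ξ N
  rw [h.interpolation hp i] at hrec
  have hd : truncNorm N (y₁ - C (s i) * y₂) ≤ (1 + ‖s i‖) * truncNorm N y₂ := by
    refine (truncNorm_sub_le _ _ _).trans ?_
    rw [truncNorm_C_mul, add_mul, one_mul]
    linarith
  have hd2 := pow_le_pow_left₀ (truncNorm_nonneg _ _) hd 2
  have hN : ‖coeff N ξ‖ ^ 2 ≤ K₀ * truncNorm N y₂ ^ 2 := by
    have := norm_sq_mulVec_le_pickForm hP i fun j => coeff N (x j)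
    have e : coeff N ξ = ∑ j, pickMatrix p s i j * coeff N (x j) := by
      rw [hξ, map_sum]
      simp_rw [coeff_C_mul]
    rw [e]
    refine this.trans (mul_le_mul_of_nonneg_left ?_ (by positivity))
    nlinarith [sq_nonneg (truncNorm N y₁)]
  have hfin : truncNorm N ξ ^ 2 ≤ K₁ * truncNorm N y₂ ^ 2 := by
    have h2 : (1 - ‖p i‖) * truncNorm N ξ ^ 2 ≤
        (K₀ + (1 - ‖p i‖)⁻¹ * (1 + ‖s i‖) ^ 2) * truncNorm N y₂ ^ 2 := by
      refine hrec.trans ?_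
      rw [add_mul, mul_assoc, ← mul_pow]
      exact add_le_add hN (mul_le_mul_of_nonneg_left hd2 (by positivity))
    calc truncNorm N ξ ^ 2 = (1 - ‖p i‖)⁻¹ * ((1 - ‖p i‖) * truncNorm N ξ ^ 2) := by
          rw [inv_mul_cancel_left₀ h1.ne']
      _ ≤ (1 - ‖p i‖)⁻¹ * ((K₀ + (1 - ‖p i‖)⁻¹ * (1 + ‖s i‖) ^ 2) * truncNorm N y₂ ^ 2) :=
          mul_le_mul_of_nonneg_left h2 (by positivity)
      _ = _ := by rw [hK₁, mul_assoc]
  refine (sq_le_sq₀ (truncNorm_nonneg _ _)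
    (mul_nonneg (Real.sqrt_nonneg _) (truncNorm_nonneg _ _))).1 ?_
  rwa [mul_pow, Real.sq_sqrt hK₁0]

/-- Subtracting the two state equations cancels v. Thus η, and with it u₂ = y₂ − N*η, is controlled
by the states alone. -/
theorem Trajectory.eta_eq_state (hp : ∀ i, p i ∈ quatBall)
    {u₁ u₂ y₁ y₂ : PowerSeries ℍ} {x η v : Fin n → PowerSeries ℍ}
    (h : Trajectory p s u₁ u₂ y₁ y₂ x η v) (i : Fin n) :
    η i = C (1 - star (p i))⁻¹ * (X * x i - x i) := by
  have h0 : 1 - star (p i) ≠ 0 := one_sub_ne_zero_of_norm_lt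
    (by rw [Quaternion.norm_star]; exact norm_lt_one_of_mem_quatBall (hp i))
  have h1 : X * x i - x i = C (1 - star (p i)) * η i := by
    rw [h.prev, h.next, map_sub, map_one, sub_mul, one_mul]
    abel
  rw [h1, ← mul_assoc, ← map_mul, inv_mul_cancel₀ h0, map_one, one_mul]

/-- The inputs are bounded by the second output if the first input is smaller than the second. -/
theorem Trajectory.exists_input_bound (hp : ∀ i, p i ∈ quatBall)
    (hP : QuatPosDef (pickMatrix p s)) :
    ∃ K : ℝ, ∀ {u₁ u₂ y₁ y₂ : PowerSeries ℍ} {x η v : Fin n → PowerSeries ℍ},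
      Trajectory p s u₁ u₂ y₁ y₂ x η v → ∀ {N : ℕ}, truncNorm N u₁ ≤ truncNorm N u₂ →
      truncNorm N u₂ ≤ K * truncNorm N y₂ := by
  choose K hK using Trajectory.exists_state_bound (s := s) hp hP
  refine ⟨1 + ∑ i, ‖star (s i)‖ * (‖(1 - star (p i))⁻¹‖ *
    (2 * ∑ j, ‖Ring.inverse (pickMatrix p s) i j‖ * K j)),
    fun {u₁ u₂ y₁ y₂ x η v} h N hu => ?_⟩
  have hx : ∀ i, truncNorm N (x i) ≤
      (∑ j, ‖Ring.inverse (pickMatrix p s) i j‖ * K j) * truncNorm N y₂ := fun i => by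
    rw [← sum_C_mul_sum_C_mul (inverse_mul_pickMatrix hP) x i, Finset.sum_mul]
    refine (truncNorm_sum_le _ _ _).trans (Finset.sum_le_sum fun j _ => ?_)
    rw [truncNorm_C_mul, mul_assoc]
    exact mul_le_mul_of_nonneg_left (hK j h hu) (norm_nonneg _)
  have hη : ∀ i, truncNorm N (η i) ≤ (‖(1 - star (p i))⁻¹‖ *
      (2 * ∑ j, ‖Ring.inverse (pickMatrix p s) i j‖ * K j)) * truncNorm N y₂ := fun i => by
    rw [h.eta_eq_state hp, truncNorm_C_mul, mul_assoc]
    refine mul_le_mul_of_nonneg_left ?_ (norm_nonneg _)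
    have h1 := truncNorm_sub_le N (X * x i) (x i)
    have h2 := truncNorm_X_mul_le N (x i)
    linarith [hx i]
  have hu₂ : u₂ = y₂ - ∑ i, C (star (s i)) * η i := by rw [h.out₂]; abel
  rw [hu₂, add_mul, one_mul, Finset.sum_mul]
  refine (truncNorm_sub_le _ _ _).trans (add_le_add le_rfl ?_)
  refine (truncNorm_sum_le _ _ _).trans (Finset.sum_le_sum fun i _ => ?_)
  rw [truncNorm_C_mul, mul_assoc]
  exact mul_le_mul_of_nonneg_left (hη i) (norm_nonneg _)

/-- The left factor vanishes at c, and every term q^j a(q) b_j of an evaluated product contains the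
value of the left factor. Convergence of h is essential, since formally X − c is invertible when c ≠
0. -/
theorem sliceEval_X_sub_C_mul {c : ℍ} (hc : c ∈ quatBall) {h : PowerSeries ℍ}
    (hh : ConvergesOnBall h) : sliceEval ((X - C c) * h) c = 0 := by
  have h1 : sliceEval (X - C c) c = 0 := by
    rw [sub_eq_add_neg, sliceEval_add convergesOnBall_X (convergesOnBall_C c).neg hc, sliceEval_X,
      ← map_neg, sliceEval_C, add_neg_cancel]
  have h2 := hasSum_sliceEval_mul (convergesOnBall_X.sub (convergesOnBall_C c)) hh hc
  simp only [h1, mul_zero, zero_mul] at h2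
  exact h2.unique hasSum_zero

/-- The linear fractional transformation of a contractive series is contractive and solves the
interpolation problem. -/
theorem exists_inverse_lft (hp : ∀ i, p i ∈ quatBall) (hP : QuatPosDef (pickMatrix p s))
    {e : PowerSeries ℍ} (he : Contractive e) :
    ∃ b : PowerSeries ℍ, (thetaSeries p s 1 0 * e + thetaSeries p s 1 1) * b = 1 ∧
      b * (thetaSeries p s 1 0 * e + thetaSeries p s 1 1) = 1 ∧ ConvergesOnBall b ∧
      Contractive ((thetaSeries p s 0 0 * e + thetaSeries p s 0 1) * b) ∧
      ∀ i, sliceEval ((thetaSeries p s 0 0 * e + thetaSeries p s 0 1) * b) (p i) = s i := by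
  obtain ⟨x, η, v, h⟩ := exists_trajectory hp hP e 1
  simp only [mul_one] at h
  set y₁ := thetaSeries p s 0 0 * e + thetaSeries p s 0 1
  set y₂ := thetaSeries p s 1 0 * e + thetaSeries p s 1 1
  have hu : ∀ g N, truncNorm N (e * g) ≤ truncNorm N (1 * g) := fun g N => by
    rw [one_mul]; exact he N g
  obtain ⟨K, hK⟩ := Trajectory.exists_input_bound (s := s) hp hP
  have h0 : constantCoeff y₂ ≠ 0 := by
    intro h0
    -- At N = 0 with g = 1 the input bound reads 1 ≤ K |y₂(0)|.
    have h1 := hK (h.mul_right 1) (hu 1 0)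
    rw [one_mul, mul_one, truncNorm_one, truncNorm_zero_left, coeff_zero_eq_constantCoeff_apply,
      h0, norm_zero, mul_zero] at h1
    exact absurd h1 (by norm_num)
  obtain ⟨b, hyb, hby⟩ := exists_inverse_of_constantCoeff_ne_zero h0
  -- Feeding in g = b makes the second output equal to 1, so the truncated norms of b are bounded by
  -- K independently of N.
  have hbK : ConvergesOnBall b := .of_bounded (K := K) fun k => by
    have h1 := hK (h.mul_right b) (hu b k)
    rw [one_mul, hyb, truncNorm_one, mul_one] at h1
    exact (norm_coeff_le_truncNorm le_rfl b).trans h1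
  have hS : Contractive (y₁ * b) := fun N g => by
    have h1 := (h.mul_right (b * g)).truncNorm_output_le hp hP (hu (b * g) N)
    rwa [← mul_assoc, ← mul_assoc, hyb, one_mul] at h1
  refine ⟨b, hyb, hby, hbK, hS, fun i => ?_⟩
  obtain ⟨K', hK'⟩ := Trajectory.exists_state_bound (s := s) hp hP i
  have hT := h.mul_right b
  have hξ : ConvergesOnBall (∑ j, C (pickMatrix p s i j) * (x j * b)) :=
    .of_bounded (K := K') fun k => by
      have h1 := hK' hT (hu b k)
      rw [hyb, truncNorm_one, mul_one] at h1
      exact (norm_coeff_le_truncNorm le_rfl _).trans h1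
  have hint := hT.interpolation hp i
  rw [hyb, mul_one, eq_sub_iff_add_eq] at hint
  rw [← hint, sliceEval_add ((convergesOnBall_X.sub (convergesOnBall_C _)).mul hξ)
    (convergesOnBall_C _) (hp i), sliceEval_X_sub_C_mul (hp i) hξ, sliceEval_C, zero_add]

end Parametrization

theorem Quaternion.re_sum {ι : Type*} (t : Finset ι) (f : ι → ℍ) :
    (∑ i ∈ t, f i).re = ∑ i ∈ t, (f i).re :=
  map_sum (AddMonoidHom.mk' (fun q : ℍ => q.re) Quaternion.re_add) f t

/-! ### From a solution to its Schur parameter -/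

section Converse

variable {n : ℕ} {p s : Fin n → ℍ}

/-- Division of a bounded power series by `X - c`, for `c` in the unit ball. -/
theorem exists_divided_difference {S : PowerSeries ℍ} (hS : ∀ k, ‖coeff k S‖ ≤ 1) {c : ℍ}
    (hc : c ∈ quatBall) :
    ∃ L : PowerSeries ℍ, ConvergesOnBall L ∧ (X - C c) * L = S - C (sliceEval S c) := by
  have hc' := norm_lt_one_of_mem_quatBall hc
  have hle : ∀ k j, ‖c ^ j * coeff (k + j) S‖ ≤ ‖c‖ ^ j := fun k j => by
    rw [norm_mul, norm_pow]
    exact mul_le_of_le_one_right (by positivity) (hS _)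
  have hsum : ∀ k, Summable fun j => c ^ j * coeff (k + j) S := fun k =>
    Summable.of_norm_bounded (summable_geometric_of_lt_one (norm_nonneg _) hc') (hle k)
  -- The tails σ_k = ∑_j c^j S_{k+j} satisfy σ_k = S_k + cσ_{k+1} and σ_0 = S(c). The coefficients
  -- of the quotient are therefore L_k = σ_{k+1}.
  have hrec : ∀ k, ∑' j, c ^ j * coeff (k + j) S =
      coeff k S + c * ∑' j, c ^ j * coeff (k + 1 + j) S := fun k => by
    rw [(hsum k).tsum_eq_zero_add, ← tsum_mul_left]
    congr 1
    · simp
    · refine tsum_congr fun j => ?_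
      rw [pow_succ', mul_assoc, add_right_comm, add_assoc]
  refine ⟨mk fun k => ∑' j, c ^ j * coeff (k + 1 + j) S, ?_, ?_⟩
  · refine .of_bounded (K := (1 - ‖c‖)⁻¹) fun k => ?_
    rw [coeff_mk, ← tsum_geometric_of_lt_one (norm_nonneg _) hc']
    exact tsum_of_norm_bounded (summable_geometric_of_lt_one (norm_nonneg _) hc').hasSum (hle _)
  · ext1 k
    cases k with
    | zero =>
      have h := hrec 0
      simp only [zero_add] at h
      simp only [sub_mul, map_sub, coeff_zero_X_mul, coeff_C_mul, coeff_mk, zero_add]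
      rw [sliceEval, h, coeff_C, if_pos rfl]
      abel
    | succ k =>
      rw [coeff_X_sub_C_mul_succ, coeff_mk, coeff_mk, hrec (k + 1), map_sub, coeff_C,
        if_neg (Nat.succ_ne_zero k)]
      abel

/-- A trajectory with prescribed outputs that satisfy the interpolation conditions. -/
theorem exists_trajectory_of_output (hp : ∀ i, p i ∈ quatBall) (hP : QuatPosDef (pickMatrix p s))
    {y₁ y₂ : PowerSeries ℍ} {L : Fin n → PowerSeries ℍ}
    (hL : ∀ i, (X - C (p i)) * L i = y₁ - C (s i) * y₂) :
    ∃ u₁ u₂ x η v, Trajectory p s u₁ u₂ y₁ y₂ x η v ∧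
      ∀ i, ∑ j, C (pickMatrix p s i j) * x j = L i := by
  -- The system is solved backwards: Px = L fixes x, the difference of the two state equations fixes
  -- η, and then v and the inputs follow. Only the input equation remains to be checked, and it
  -- follows from the Stein identity.
  set x : Fin n → PowerSeries ℍ := fun i => ∑ j, C (Ring.inverse (pickMatrix p s) i j) * L j with hx
  set η : Fin n → PowerSeries ℍ := fun i => C (1 - star (p i))⁻¹ * (X * x i - x i) with hη
  set v : Fin n → PowerSeries ℍ := fun i => x i - C (star (p i)) * η i with hv
  have hPx : ∀ i, ∑ j, C (pickMatrix p s i j) * x j = L i := fun i =>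
    sum_C_mul_sum_C_mul (pickMatrix_mul_inverse hP) L i
  have h1 : ∀ i, η i - C (star (p i)) * η i = X * x i - x i := fun i => by
    have h0 : 1 - star (p i) ≠ 0 := one_sub_ne_zero_of_norm_lt
      (by rw [Quaternion.norm_star]; exact norm_lt_one_of_mem_quatBall (hp i))
    have : η i - C (star (p i)) * η i = C (1 - star (p i)) * η i := by
      rw [map_sub, map_one, sub_mul, one_mul]
    rw [this, hη, ← mul_assoc, ← map_mul, mul_inv_cancel₀ h0, map_one, one_mul]
  refine ⟨y₁ - ∑ i, η i, y₂ - ∑ i, C (star (s i)) * η i, x, η, v,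
    ⟨fun i => ?_, fun i => ?_, by abel, by abel, fun i => ?_⟩, hPx⟩
  · simp only [hv]; abel
  · have := h1 i
    rw [sub_eq_sub_iff_add_eq_add] at this
    simp only [hv]
    rw [← add_sub_assoc, this]
    abel
  · set A := ∑ j, C (pickMatrix p s i j) * η j with hA
    set B := ∑ j, C (pickMatrix p s i j * star (p j)) * η j with hB
    have e1 : ∑ j, C (pickMatrix p s i j) * v j = L i - B := by
      rw [← hPx i, hB, ← Finset.sum_sub_distrib]
      refine Finset.sum_congr rfl fun j _ => ?_
      simp only [hv, map_mul]
      noncomm_ring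
    have e2 : A - B = X * L i - L i := by
      rw [← hPx i, hA, hB, Finset.mul_sum, ← Finset.sum_sub_distrib, ← Finset.sum_sub_distrib]
      refine Finset.sum_congr rfl fun j _ => ?_
      rw [X_mul_left_comm, ← mul_sub, ← h1, map_mul]
      noncomm_ring
    have e3 : A - C (p i) * B = ∑ j, η j - C (s i) * ∑ j, C (star (s j)) * η j := by
      rw [hA, hB, Finset.mul_sum, Finset.mul_sum, ← Finset.sum_sub_distrib,
        ← Finset.sum_sub_distrib]
      refine Finset.sum_congr rfl fun j _ => ?_
      calc _ = C (pickMatrix p s i j - p i * pickMatrix p s i j * star (p j)) * η j := by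
            rw [map_sub, map_mul, map_mul, map_mul]
            noncomm_ring
        _ = _ := by
            rw [pickMatrix_stein hp, map_sub, map_mul, map_one]
            noncomm_ring
    have e4 : X * L i - C (p i) * L i = y₁ - C (s i) * y₂ := by rw [← hL, sub_mul]
    have e5 : y₁ - ∑ j, η j - C (s i) * (y₂ - ∑ j, C (star (s j)) * η j) =
        (y₁ - C (s i) * y₂) - (∑ j, η j - C (s i) * ∑ j, C (star (s j)) * η j) := by
      rw [mul_sub]; abel
    have e6 : A = X * L i - L i + B := by rw [← e2]; abel
    rw [e5, e1, ← e3, ← e4, e6, map_sub, map_one, sub_mul, one_mul, mul_sub]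
    abel

theorem ConvergesOnBall.tendsto_pow_mul {l : PowerSeries ℍ} (hl : ConvergesOnBall l) {c : ℍ}
    (hc : c ∈ quatBall) (N : ℕ) :
    Filter.Tendsto (fun m => c ^ m * coeff (N + m) l) Filter.atTop (nhds 0) := by
  have hc' := norm_lt_one_of_mem_quatBall hc
  obtain ⟨r, hcr, hr1⟩ := exists_between hc'
  have hr0 : 0 < r := (norm_nonneg _).trans_lt hcr
  have h1 := (hl r hr0.le hr1).tendsto_atTop_zero.comp (Filter.tendsto_add_atTop_nat N)
  have h2 := h1.const_mul (r ^ N)⁻¹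
  rw [mul_zero] at h2
  refine squeeze_zero_norm (fun m => ?_) h2
  rw [norm_mul, norm_pow, Function.comp_apply, add_comm m N, pow_add]
  have h3 : (r ^ N)⁻¹ * (‖coeff (N + m) l‖ * (r ^ N * r ^ m)) = r ^ m * ‖coeff (N + m) l‖ := by
    field_simp
  rw [h3]
  gcongr

theorem coeff_eq_sum_add_of_recursion (c : ℍ) (l : PowerSeries ℍ) (N m : ℕ) :
    coeff N l = ∑ k ∈ Finset.range m, c ^ k * coeff (N + 1 + k) ((X - C c) * l) +
      c ^ m * coeff (N + m) l := by
  induction m with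
  | zero => simp
  | succ m ih =>
    rw [Finset.sum_range_succ, add_assoc, pow_succ, mul_assoc, ← mul_add,
      show N + 1 + m = N + m + 1 by ring, coeff_X_sub_C_mul_succ, ← add_assoc N m 1,
      sub_add_cancel]
    exact ih

/-- The telescoped Stein identity for the zero input response. -/
theorem sum_zero_input_response (hp : ∀ i, p i ∈ quatBall) (x : Fin n → ℍ) (m : ℕ) :
    ∑ k ∈ Finset.range m, (‖∑ i, star (p i) ^ k * x i‖ ^ 2 -
        ‖∑ i, star (s i) * (star (p i) ^ k * x i)‖ ^ 2) =
      pickForm p s x x -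
        pickForm p s (fun i => star (p i) ^ m * x i) (fun i => star (p i) ^ m * x i) := by
  induction m with
  | zero => simp
  | succ m ih =>
    rw [Finset.sum_range_succ, ih, ← pickForm_stein hp]
    simp only [pow_succ', mul_assoc]
    ring

theorem coeff_mul_congr_right {a g g' : PowerSeries ℍ} {N : ℕ}
    (h : ∀ k ≤ N, coeff k g = coeff k g') {k : ℕ} (hk : k ≤ N) :
    coeff k (a * g) = coeff k (a * g') := by
  rw [coeff_mul, coeff_mul]
  refine Finset.sum_congr rfl fun q hq => ?_
  rw [h q.2 (by have := Finset.HasAntidiagonal.mem_antidiagonal.1 hq; omega)]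

/-- The fundamental matrix inequality for a solution of the interpolation problem. -/
theorem Trajectory.fundamental_inequality (hp : ∀ i, p i ∈ quatBall)
    (hP : QuatPosDef (pickMatrix p s)) {S : PowerSeries ℍ} (hS : Contractive S)
    {u₁ u₂ : PowerSeries ℍ} {x η v : Fin n → PowerSeries ℍ}
    (h : Trajectory p s u₁ u₂ S 1 x η v)
    (hL : ∀ i, ConvergesOnBall (∑ j, C (pickMatrix p s i j) * x j))
    (g : PowerSeries ℍ) (N : ℕ) :
    pickForm p s (fun i => coeff N (x i * g)) (fun i => coeff N (x i * g)) +
      truncNorm N (S * g) ^ 2 ≤ truncNorm N g ^ 2 := by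
  set z : Fin n → ℍ := fun i => coeff N (x i * g) with hz
  -- Past index N the series g is continued by N*T*^m z, the second output of the system left to run
  -- freely from the state z. Contractivity of S on this longer input is what brings in the energy
  -- of z.
  let G : PowerSeries ℍ := PowerSeries.mk fun k => if k ≤ N then coeff k g else
    ∑ i, star (s i) * (star (p i) ^ (k - (N + 1)) * z i)
  have hGlow : ∀ k ≤ N, coeff k G = coeff k g := fun k hk => by simp [G, hk]
  have hGhigh : ∀ m, coeff (N + 1 + m) G = ∑ i, star (s i) * (star (p i) ^ m * z i) := fun m => by
    have h1 : ¬ N + 1 + m ≤ N := by omega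
    have h2 : N + 1 + m - (N + 1) = m := by omega
    simp only [G, coeff_mk, if_neg h1, h2]
  have hGconv : ConvergesOnBall G := by
    refine .of_bounded (K := truncNorm N g + ∑ i, ‖s i‖ * ‖z i‖) fun k => ?_
    rcases le_or_gt k N with hk | hk
    · rw [hGlow k hk]
      exact (norm_coeff_le_truncNorm hk g).trans (le_add_of_nonneg_right (by positivity))
    · obtain ⟨m, rfl⟩ := Nat.exists_eq_add_of_le (Nat.succ_le_of_lt hk)
      rw [Nat.succ_eq_add_one, hGhigh]
      refine le_trans ((norm_sum_le _ _).trans (Finset.sum_le_sum fun i _ => ?_))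
        (le_add_of_nonneg_left (truncNorm_nonneg _ _))
      rw [norm_mul, norm_mul, norm_pow, Quaternion.norm_star, Quaternion.norm_star]
      refine mul_le_mul_of_nonneg_left (mul_le_of_le_one_left (norm_nonneg _)
        (pow_le_one₀ (norm_nonneg _) (norm_lt_one_of_mem_quatBall (hp i)).le)) (norm_nonneg _)
  set l : Fin n → PowerSeries ℍ := fun i => (∑ j, C (pickMatrix p s i j) * x j) * G with hl
  have hlconv : ∀ i, ConvergesOnBall (l i) := fun i => (hL i).mul hGconv
  have hlrec : ∀ i, (X - C (p i)) * l i = S * G - C (s i) * G := fun i => by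
    rw [hl, ← mul_assoc, h.interpolation hp, mul_one, sub_mul]
  have hlN : ∀ i, coeff N (l i) = ∑ j, pickMatrix p s i j * z j := fun i => by
    simp only [hl, Finset.sum_mul, map_sum, mul_assoc, coeff_C_mul]
    refine Finset.sum_congr rfl fun j _ => ?_
    rw [coeff_mul_congr_right hGlow le_rfl]
  have hGN : truncNorm N G = truncNorm N g := truncNorm_congr hGlow
  have hSGN : truncNorm N (S * G) = truncNorm N (S * g) :=
    truncNorm_congr fun k hk => coeff_mul_congr_right hGlow hk
  have hQ : pickForm p s z z = ∑ i, (star (z i) * coeff N (l i)).re := by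
    rw [pickForm]
    simp_rw [hlN]
    exact Quaternion.re_sum _ _
  let ε : ℕ → ℝ := fun m => ∑ i, (star (z i) * (p i ^ m * coeff (N + m) (l i))).re
  have hε : Filter.Tendsto ε Filter.atTop (nhds 0) := by
    have h1 : Filter.Tendsto ε Filter.atTop (nhds (∑ i : Fin n, 0)) := by
      refine tendsto_finsetSum _ fun i _ => ?_
      have h2 := ((hlconv i).tendsto_pow_mul (hp i) N).const_mul (star (z i))
      rw [mul_zero] at h2
      exact (Quaternion.continuous_re.tendsto _).comp h2
    simpa using h1
  have hstep : ∀ m, pickForm p s z z + truncNorm N (S * g) ^ 2 - 2 * ε m ≤ truncNorm N g ^ 2 := by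
    intro m
    have hc := pow_le_pow_left₀ (truncNorm_nonneg _ _) (hS (N + m) G) 2
    rw [truncNorm_sq, truncNorm_sq, show N + m + 1 = N + 1 + m by ring, Finset.sum_range_add _ (N + 1) m,
      Finset.sum_range_add _ (N + 1) m, ← truncNorm_sq, ← truncNorm_sq, hGN, hSGN] at hc
    have hst := sum_zero_input_response (s := s) hp z m
    have hnn := pickForm_nonneg hP fun i => star (p i) ^ m * z i
    -- With w = E*T*^k z, e = N*T*^k z and y the coefficient of SG, this is 2 Re(w*y) ≤ |w|² + |y|².
    -- Summed over k, Re(w*y) − |e|² telescopes to z*Pz − ε_m, while |w|² − |e|² sums to at most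
    -- z*Pz. The tail thus contributes at least z*Pz − 2ε_m.
    have hpt : ∀ k, 2 * (∑ i, (star (z i) *
        (p i ^ k * coeff (N + 1 + k) ((X - C (p i)) * l i))).re) -
        (‖∑ i, star (p i) ^ k * z i‖ ^ 2 - ‖∑ i, star (s i) * (star (p i) ^ k * z i)‖ ^ 2) ≤
        ‖coeff (N + 1 + k) (S * G)‖ ^ 2 - ‖coeff (N + 1 + k) G‖ ^ 2 := by
      intro k
      set y := coeff (N + 1 + k) (S * G)
      set w := ∑ i, star (p i) ^ k * z i with hw
      set e := ∑ i, star (s i) * (star (p i) ^ k * z i) with he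
      have h1 : ∑ i, (star (z i) * (p i ^ k * coeff (N + 1 + k) ((X - C (p i)) * l i))).re =
          (star w * y).re - (star e * e).re := by
        have h2 : star w * y - star e * e =
            ∑ i, star (z i) * (p i ^ k * coeff (N + 1 + k) ((X - C (p i)) * l i)) := by
          have hmul : star e * e = star e * coeff (N + 1 + k) G := by rw [hGhigh]
          rw [hmul, hw, he, star_sum, star_sum, Finset.sum_mul, Finset.sum_mul,
            ← Finset.sum_sub_distrib]
          refine Finset.sum_congr rfl fun i _ => ?_
          rw [hlrec, map_sub, coeff_C_mul]
          simp only [star_mul, star_star, star_pow]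
          noncomm_ring
        rw [← Quaternion.re_sub, h2]
        exact (Quaternion.re_sum _ _).symm
      have h3 : ∀ a : ℍ, (star a * a).re = ‖a‖ ^ 2 := fun a => by
        simpa using Quaternion.re_star_smul_mul_self 1 a
      have h4 : 2 * (star w * y).re ≤ ‖w‖ ^ 2 + ‖y‖ ^ 2 := by
        have := Quaternion.re_le_norm (star w * y)
        rw [norm_mul, Quaternion.norm_star] at this
        nlinarith [sq_nonneg (‖w‖ - ‖y‖)]
      rw [h1, hGhigh, h3]
      linarith
    have hsum := Finset.sum_le_sum fun k (_ : k ∈ Finset.range m) => hpt k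
    rw [Finset.sum_sub_distrib, Finset.sum_sub_distrib (f := fun k => ‖coeff (N + 1 + k) (S * G)‖ ^ 2),
      hst, ← Finset.mul_sum] at hsum
    have htel : ∑ k ∈ Finset.range m, ∑ i, (star (z i) *
        (p i ^ k * coeff (N + 1 + k) ((X - C (p i)) * l i))).re = pickForm p s z z - ε m := by
      rw [Finset.sum_comm, hQ, ← Finset.sum_sub_distrib]
      refine Finset.sum_congr rfl fun i _ => ?_
      rw [← Quaternion.re_sub, ← mul_sub,
        sub_eq_of_eq_add (coeff_eq_sum_add_of_recursion (p i) (l i) N m), Finset.mul_sum]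
      exact (Quaternion.re_sum _ _).symm
    rw [htel] at hsum
    linarith
  have hlim := (tendsto_const_nhds (x := pickForm p s z z + truncNorm N (S * g) ^ 2)).sub
    (hε.const_mul 2)
  rw [mul_zero, sub_zero] at hlim
  exact le_of_tendsto hlim (Filter.Eventually.of_forall hstep)

/-- Every contractive solution of the interpolation problem is a linear fractional
transformation of a contractive series. -/
theorem exists_lft_of_interpolation (hp : ∀ i, p i ∈ quatBall)
    (hP : QuatPosDef (pickMatrix p s)) {S : PowerSeries ℍ} (hS : Contractive S)
    (hSp : ∀ i, sliceEval S (p i) = s i) :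
    ∃ e b : PowerSeries ℍ, Contractive e ∧
      (thetaSeries p s 1 0 * e + thetaSeries p s 1 1) * b = 1 ∧
      S = (thetaSeries p s 0 0 * e + thetaSeries p s 0 1) * b := by
  choose L hLc hL using fun i => exists_divided_difference hS.norm_coeff_le (hp i)
  have hL' : ∀ i, (X - C (p i)) * L i = S - C (s i) * 1 := fun i => by
    rw [hL, hSp, mul_one]
  obtain ⟨a, b, x, η, v, h, hxL⟩ := exists_trajectory_of_output hp hP hL'
  have hab : ∀ N g, truncNorm N (a * g) ≤ truncNorm N (b * g) := fun N g => by
    have h1 := h.fundamental_inequality hp hP hS (fun i => by rw [hxL]; exact hLc i) g N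
    have h2 := (h.mul_right g).energy hp hP N
    rw [one_mul] at h2
    refine (sq_le_sq₀ (truncNorm_nonneg _ _) (truncNorm_nonneg _ _)).1 ?_
    linarith
  -- If b(0) = 0, the inequality forces a(0) = 0. With zero initial state every signal then vanishes
  -- at time 0, contradicting the second output 1.
  have h0 : constantCoeff b ≠ 0 := by
    intro hb
    have ha := hab 0 1
    rw [mul_one, mul_one, truncNorm_zero_left, truncNorm_zero_left,
      coeff_zero_eq_constantCoeff_apply, coeff_zero_eq_constantCoeff_apply, hb, norm_zero,
      norm_le_zero_iff] at ha
    have hv : ∀ i, constantCoeff (v i) = 0 := fun i => by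
      rw [h.input_eq hp hP]
      simp [ha, hb]
    have hη : ∀ i, constantCoeff (η i) = 0 := fun i => by
      have := congrArg constantCoeff (h.prev i)
      rw [map_add, hv, add_zero] at this
      simpa using this.symm
    have h1 := congrArg constantCoeff h.out₂
    simp [hb, hη] at h1
  obtain ⟨B, hbB, hBb⟩ := exists_inverse_of_constantCoeff_ne_zero h0
  obtain ⟨o₁, o₂⟩ := h.output hp hP
  have hy₁ : thetaSeries p s 0 0 * (a * B) + thetaSeries p s 0 1 = S * B := by
    rw [o₁, add_mul, mul_assoc, mul_assoc, hbB, mul_one]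
  have hy₂ : thetaSeries p s 1 0 * (a * B) + thetaSeries p s 1 1 = B := by
    conv_rhs => rw [← one_mul B, o₂]
    rw [add_mul, mul_assoc, mul_assoc, hbB, mul_one]
  refine ⟨a * B, b, fun N g => ?_, ?_, ?_⟩
  · have := hab N (B * g)
    rwa [← mul_assoc, ← mul_assoc, hbB, one_mul] at this
  · rw [hy₂, hBb]
  · rw [hy₁, mul_assoc, hBb, mul_one]

end Converse

/-! ### Return from series to functions -/

section Main

variable {n : ℕ} {p s : Fin n → ℍ}

theorem sliceTaylor_thetaEntry (hp : ∀ i, p i ∈ quatBall) (a b : Fin 2) :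
    sliceTaylor (thetaEntry p s a b) = thetaSeries p s a b :=
  sliceTaylor_eq (convergesOnBall_thetaSeries hp a b) fun _ hq => thetaEntry_eq_sliceEval hp a b hq

theorem sliceTaylor_lft (hp : ∀ i, p i ∈ quatBall) {e : ℍ → ℍ}
    (he : ConvergesOnBall (sliceTaylor e)) (a : Fin 2) :
    sliceTaylor (fun q => sliceMul (thetaEntry p s a 0) e q + thetaEntry p s a 1 q) =
      thetaSeries p s a 0 * sliceTaylor e + thetaSeries p s a 1 := by
  have h1 := (convergesOnBall_thetaSeries (s := s) hp a 0).mul he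
  have h2 := convergesOnBall_thetaSeries (s := s) hp a 1
  refine sliceTaylor_eq (h1.add h2) fun q hq => ?_
  rw [sliceEval_add h1 h2 hq, sliceMul, sliceTaylor_thetaEntry hp,
    thetaEntry_eq_sliceEval hp a 1 hq]

/-- The linear fractional transformation in terms of Taylor series. -/
theorem lft_eq_sliceEval (hp : ∀ i, p i ∈ quatBall) {e : ℍ → ℍ}
    (he : ConvergesOnBall (sliceTaylor e)) {b : PowerSeries ℍ} (hb : ConvergesOnBall b)
    (h1 : (thetaSeries p s 1 0 * sliceTaylor e + thetaSeries p s 1 1) * b = 1)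
    (h2 : b * (thetaSeries p s 1 0 * sliceTaylor e + thetaSeries p s 1 1) = 1) :
    SliceInvertible (lftDen p s e) ∧
      sliceMul (lftNum p s e) (sliceInv (lftDen p s e)) =
        sliceEval ((thetaSeries p s 0 0 * sliceTaylor e + thetaSeries p s 0 1) * b) := by
  have hden : ConvergesOnBall (thetaSeries p s 1 0 * sliceTaylor e + thetaSeries p s 1 1) :=
    ((convergesOnBall_thetaSeries hp 1 0).mul he).add (convergesOnBall_thetaSeries hp 1 1)
  have hT : sliceTaylor (lftDen p s e) = _ := sliceTaylor_lft hp he 1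
  refine ⟨sliceInvertible_of_mul_eq_one hden hb h1 h2 hT, ?_⟩
  have hN : sliceTaylor (lftNum p s e) = _ := sliceTaylor_lft hp he 0
  rw [sliceMul, hN, sliceTaylor_eq hb fun q hq => sliceInv_eq hden hb h1 h2 hT hq]

end Main

theorem theoremT (n : ℕ) (p s : Fin n → ℍ) (hp : ∀ i, p i ∈ quatBall)
    (hinj : Function.Injective p) (hP : QuatPosDef (pickMatrix p s)) :
    (∀ i j, SliceRegularOn (thetaEntry p s i j) quatBall) ∧
    (∀ e : ℍ → ℍ, SliceSchur e → SliceInvertible (lftDen p s e)) ∧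
    (∀ S : ℍ → ℍ, SolvesNP p s S ↔
      ∃ e : ℍ → ℍ, SliceSchur e ∧
        ∀ q ∈ quatBall, S q = sliceMul (lftNum p s e) (sliceInv (lftDen p s e)) q) := by
  refine ⟨fun i j => (convergesOnBall_thetaSeries hp i j).sliceRegularOn.congr isOpen_quatBall
    fun q hq => thetaEntry_eq_sliceEval hp i j hq, fun e he => ?_, fun S => ⟨fun hS => ?_, ?_⟩⟩
  · obtain ⟨b, h1, h2, hb, -, -⟩ := exists_inverse_lft hp hP he.contractive
    exact (lft_eq_sliceEval hp he.1.convergesOnBall hb h1 h2).1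
  · obtain ⟨e, b, he, h1, hSeq⟩ := exists_lft_of_interpolation hp hP hS.1.contractive
      fun i => by rw [← hS.1.1.eq_sliceEval (hp i)]; exact hS.2 i
    have hT : sliceTaylor (sliceEval e) = e := sliceTaylor_eq he.convergesOnBall fun _ _ => rfl
    obtain ⟨b', h1', h2', hb', -, -⟩ := exists_inverse_lft hp hP he
    -- Here b is only known to be a formal right inverse. Uniqueness identifies it with the
    -- convergent two-sided inverse supplied by the forward direction.
    have hbb : b = b' := by rw [← one_mul b, ← h2', mul_assoc, h1, mul_one]
    refine ⟨sliceEval e, he.sliceSchur, fun q hq => ?_⟩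
    rw [(lft_eq_sliceEval hp (by rw [hT]; exact he.convergesOnBall) hb' (by rwa [hT])
      (by rwa [hT])).2, hT, hS.1.1.eq_sliceEval hq, ← hbb, ← hSeq]
  · rintro ⟨e, he, hSe⟩
    obtain ⟨b, h1, h2, hb, hc, hint⟩ := exists_inverse_lft hp hP he.contractive
    rw [(lft_eq_sliceEval hp he.1.convergesOnBall hb h1 h2).2] at hSe
    have hSch := hc.sliceSchur
    refine ⟨⟨hSch.1.congr isOpen_quatBall hSe, fun q hq => ?_⟩, fun i => ?_⟩
    · rw [hSe q hq]; exact hSch.2 q hq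
    · rw [hSe _ (hp i)]; exact hint i
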